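/- Let $p$ be a prime and let $K$ be a field of characteristic $0$, complete for a nonarchimedean absolute value with $|p|=p^{-1}$; fix an algebraic closure $K^{\mathrm{alg}}$. For $k\ge 1$ let $\Gamma_k$ be the group of $p^k$-th roots of unity in $K^{\mathrm{alg}}$, $\Gamma=\bigcup_k\Gamma_k$, and give $K(\Gamma)$ the unique absolute value extending that of $K$. Let $n\ge 0$ and $\rho\in\mathbb{R}_{>0}^n$. For $\alpha,\beta\in\mathbb{R}_{>0}^n$ with $\alpha_i<\rho_i<\beta_i$ for all $i$, put $J=[\alpha,\beta]=\prod_i[\alpha_i,\beta_i]$ and let $K_{J,n}$ be the ring of Laurent series $f=\sum_{i\in\mathbb{Z}^n}f_it^i$ over $K$ with $|f_i|\sigma^i\to 0$ for every $\sigma\in J$; for $f\in K_{J,n}$, or $f\in K_{J,n}\otimes_KK(\Gamma)$ viewed as a Laurent series over $K(\Gamma)$, put $|f|_J=\sup_{\sigma\in J}\sup_i|f_i|\sigma^i$, and let the norm $|\cdot|_J$ of a matrix be the maximum of the norms of its entries. Let $R_\rho=\varinjlim_J K_{J,n}=\bigcup_JK_{J,n}$. The group $\Gamma^n$ acts on $K_{J,n}\otimes_KK(\Gamma)$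 and on $R_\rho\otimes_KK(\Gamma)$ by $\zeta^*(f(t))=f(\zeta t)$. An object of $\mathscr{C}_\rho$ is a finite free $R_\rho$-module $P$ with a semilinear action $\zeta\mapsto\zeta^*$ of the group $\Gamma^n$ on $P\otimes_KK(\Gamma)$ such that: (a) for some $J=[\alpha,\beta]$ as above, $P$ with its action is induced by extension of scalars from a finite free $K_{J,n}$-module $P'$ with a semilinear action of $\Gamma^n$ on $P'\otimes_KK(\Gamma)$, and for some basis of $P'$ there is $l>0$ such that for all $k\ge1$ and $\zeta\in\Gamma_k^n$ the matrix $E(\zeta)$ of $\zeta^*$ in this basis satisfies $|E(\zeta)|_J\le p^{lk}$ (we say that $P$ is defined by $P'$ over $J$); (b) $\tau(\zeta^*(x))=\tau(\zeta)^*(\tau(x))$ for all $\tau\in\mathrm{Gal}(K(\Gamma)/K)$, $\zeta\in\Gamma^n$ and $x\in P\otimes_KK(\Gamma)$. Let $P$ be an object of $\mathscr{C}_\rho$ of rank $m$, defined by $P'$ over $J=[\alpha,\beta]$, and let $e_1,\dots,e_m$ be a basis of $P'$. An exponent of $P$ (admitted by $P'$, with respect to this basis) is an $n$-tuple $A=(A^1,\dots,A^n)$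 of diagonal $m\times m$ matrices over $\mathbb{Z}_p$ for which there are matrices $S_{k,A}\in \mathrm{M}_m(K_{J,n})$, $k\ge 1$, such that: (1) putting $(v_{k,1},\dots,v_{k,m})=(e_1,\dots,e_m)S_{k,A}$, one has $\zeta^*(v_{k,1},\dots,v_{k,m})=(v_{k,1},\dots,v_{k,m})\,\zeta^A$ for all $k\ge1$ and $\zeta\in\Gamma_k^n$, where $\zeta^A=\prod_{r=1}^n\zeta_r^{A^r}$ is the diagonal matrix with $j$-th entry $\prod_r\zeta_r^{A^r_{jj}}$; (2) there is $l>0$ with $|S_{k,A}|_J\le p^{lk}$ for all $k\ge1$; (3) $|\det S_{k,A}|_J\ge 1$ for all $k\ge1$. **Theorem.** Every object $P$ of $\mathscr{C}_\rho$ has an exponent. More precisely, for every $J$ and every $P'$ by which $P$ is defined over $J$, there is an $n$-tuple $A$ of diagonal matrices over $\mathbb{Z}_p$ which is an exponent of $P$ admitted by $P'$, with respect to every basis of $P'$. -/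

import Mathlib

noncomputable section

open Filter Topology TensorProduct

namespace PAdicFuchs

universe u v

/-! ### Laurent series converging on polyannuli -/

/-- The space `ℝ_{>0}^n` of polyradii. -/
abbrev Radii (n : ℕ) : Type := Fin n → Set.Ioi (0 : ℝ)

/-- The monomial value `σ^i = σ_1^{i_1} ⋯ σ_n^{i_n}`. -/
def wt {n : ℕ} (σ : Radii n) (i : Fin n → ℤ) : ℝ := ∏ j, (σ j : ℝ) ^ (i j)

theorem wt_pos {n : ℕ} (σ : Radii n) (i : Fin n → ℤ) : 0 < wt σ i :=
  Finset.prod_pos fun j _ => zpow_pos (σ j).2 _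

theorem wt_add {n : ℕ} (σ : Radii n) (i j : Fin n → ℤ) : wt σ (i + j) = wt σ i * wt σ j := by
  simp only [wt, Pi.add_apply, ← Finset.prod_mul_distrib]
  exact Finset.prod_congr rfl fun a _ => zpow_add₀ (ne_of_gt (σ a).2) _ _

/-- A formal Laurent series `∑ f_i t^i` satisfies `|f_i| σ^i → 0` as `|i| → ∞`. -/
def Decays {K : Type u} [NontriviallyNormedField K] {n : ℕ} (f : (Fin n → ℤ) → K) (σ : Radii n) :
    Prop :=
  Tendsto (fun i => ‖f i‖ * wt σ i) cofinite (𝓝 0)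

/-- The Cauchy product of two formal Laurent series. -/
def conv {K : Type u} [NontriviallyNormedField K] {n : ℕ} (f g : (Fin n → ℤ) → K) :
    (Fin n → ℤ) → K :=
  fun k => ∑' i, f i * g (k - i)

section Convolution

variable {K : Type u} [NontriviallyNormedField K] {n : ℕ} {σ : Radii n}
  {f g h : (Fin n → ℤ) → K}

theorem Decays.zero : Decays (0 : (Fin n → ℤ) → K) σ := by
  refine tendsto_const_nhds.congr fun i => ?_
  simp

theorem Decays.add (hf : Decays f σ) (hg : Decays g σ) : Decays (f + g) σ := by
  have := Tendsto.add hf hg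
  rw [add_zero] at this
  refine squeeze_zero (fun i => mul_nonneg (norm_nonneg _) (wt_pos σ i).le) (fun i => ?_) this
  rw [← add_mul]
  exact mul_le_mul_of_nonneg_right (norm_add_le _ _) (wt_pos σ i).le

theorem Decays.smul (c : K) (hf : Decays f σ) : Decays (c • f) σ := by
  have := Tendsto.const_mul ‖c‖ hf
  rw [mul_zero] at this
  refine this.congr fun i => ?_
  simp [mul_assoc]

theorem Decays.bound (hf : Decays f σ) : ∃ C, ∀ i, ‖f i‖ * wt σ i ≤ C := by
  obtain ⟨C, hC⟩ := hf.bddAbove_range_of_cofinite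
  exact ⟨C, fun i => hC ⟨i, rfl⟩⟩

theorem Decays.single (i₀ : Fin n → ℤ) (c : K) : Decays (Pi.single i₀ c) σ := by
  refine tendsto_const_nhds.congr' ?_
  rw [EventuallyEq, eventually_cofinite]
  refine (Set.finite_singleton i₀).subset fun i hi => ?_
  by_contra hne
  exact hi (by simp [Pi.single_eq_of_ne (show i ≠ i₀ from hne)])

theorem Decays.prod_tendsto (hf : Decays f σ) (hg : Decays g σ) :
    Tendsto (fun q : (Fin n → ℤ) × (Fin n → ℤ) => ‖f q.1 * g q.2‖ * wt σ (q.1 + q.2))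
      cofinite (𝓝 0) := by
  refine (tendsto_mul_cofinite_nhds_zero hf hg).congr fun q => ?_
  rw [wt_add, norm_mul]; ring

variable [CompleteSpace K] [IsUltrametricDist K]

theorem Decays.summable (hf : Decays f σ) (hg : Decays g σ) (k : Fin n → ℤ) :
    Summable fun i => f i * g (k - i) := by
  apply NonarchimedeanAddGroup.summable_of_tendsto_cofinite_zero
  rw [tendsto_zero_iff_norm_tendsto_zero]
  have hinj : Function.Injective fun i : Fin n → ℤ => (i, k - i) := fun a b hab =>
    (Prod.ext_iff.1 hab).1
  have := ((hf.prod_tendsto hg).comp hinj.tendsto_cofinite).mul_const (wt σ k)⁻¹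
  rw [zero_mul] at this
  refine this.congr fun i => ?_
  simp [mul_assoc, (wt_pos σ k).ne']

theorem norm_tsum_le {ι : Type*} {a : ι → K} (ha : Summable a) {C : ℝ} (hC : 0 ≤ C)
    (h : ∀ i, ‖a i‖ ≤ C) : ‖∑' i, a i‖ ≤ C :=
  le_of_tendsto ha.hasSum.norm <| Eventually.of_forall fun _ =>
    IsUltrametricDist.norm_sum_le_of_forall_le_of_nonneg hC fun i _ => h i

theorem Decays.conv (hf : Decays f σ) (hg : Decays g σ) : Decays (conv f g) σ := by
  rw [Decays, Metric.tendsto_nhds]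
  intro ε hε
  have h := Metric.tendsto_nhds.1 (hf.prod_tendsto hg) (ε / 2) (half_pos hε)
  rw [eventually_cofinite] at h ⊢
  refine (h.image fun q => q.1 + q.2).subset fun k hk => ?_
  by_contra hcon
  apply hk
  have hle : ‖PAdicFuchs.conv f g k‖ ≤ ε / 2 * (wt σ k)⁻¹ := by
    refine norm_tsum_le (hf.summable hg k)
      (mul_nonneg (half_pos hε).le (inv_nonneg.2 (wt_pos σ k).le)) fun i => ?_
    have h1 : ¬ ¬ dist (‖f i * g (k - i)‖ * wt σ (i + (k - i))) 0 < ε / 2 := fun h1 =>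
      hcon ⟨(i, k - i), h1, by simp⟩
    rw [not_not, add_sub_cancel, Real.dist_0_eq_abs] at h1
    rw [← div_eq_mul_inv, le_div_iff₀ (wt_pos σ k)]
    exact (le_abs_self _).trans h1.le
  rw [Real.dist_0_eq_abs, abs_of_nonneg (mul_nonneg (norm_nonneg _) (wt_pos σ k).le)]
  rw [← div_eq_mul_inv, le_div_iff₀ (wt_pos σ k)] at hle
  linarith

theorem conv_comm (f g : (Fin n → ℤ) → K) : conv f g = conv g f := by
  funext k
  simp only [conv]
  rw [← (Equiv.subLeft k).tsum_eq]
  exact tsum_congr fun i => by simp [mul_comm]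

theorem one_conv (f : (Fin n → ℤ) → K) : conv (Pi.single 0 1) f = f := by
  funext k
  simp only [conv]
  rw [tsum_eq_single 0 fun i hi => by simp [Pi.single_eq_of_ne hi]]
  simp

theorem conv_add (hf : Decays f σ) (hg : Decays g σ) (hh : Decays h σ) :
    conv f (g + h) = conv f g + conv f h := by
  funext k
  simp only [conv, Pi.add_apply, mul_add]
  exact (hf.summable hg k).tsum_add (hf.summable hh k)

theorem smul_conv (c : K) (f g : (Fin n → ℤ) → K) : conv (c • f) g = c • conv f g := by
  funext k
  simp only [conv, Pi.smul_apply, smul_eq_mul, mul_assoc]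
  exact tsum_mul_left

theorem conv_assoc (hf : Decays f σ) (hg : Decays g σ) (hh : Decays h σ) :
    conv (conv f g) h = conv f (conv g h) := by
  funext k
  have hs : Summable (Function.uncurry fun (s i : Fin n → ℤ) => f i * g (s - i) * h (k - s)) := by
    apply NonarchimedeanAddGroup.summable_of_tendsto_cofinite_zero
    rw [tendsto_zero_iff_norm_tendsto_zero]
    have hinj : Function.Injective fun q : (Fin n → ℤ) × (Fin n → ℤ) => (q.2, q.1 - q.2) := by
      rintro ⟨a, b⟩ ⟨c, d⟩ hab
      simp only [Prod.mk.injEq] at hab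
      obtain ⟨rfl, h2⟩ := hab
      simpa using h2
    obtain ⟨C, hC⟩ := hh.bound
    have := ((hf.prod_tendsto hg).comp hinj.tendsto_cofinite).mul_const (C * (wt σ k)⁻¹)
    rw [zero_mul] at this
    refine squeeze_zero (fun _ => norm_nonneg _) (fun q => ?_) this
    obtain ⟨s, i⟩ := q
    simp only [Function.uncurry, Function.comp, add_sub_cancel]
    rw [norm_mul, mul_assoc, ← div_eq_mul_inv]
    refine mul_le_mul_of_nonneg_left ?_ (norm_nonneg _)
    rw [← mul_div_assoc, le_div_iff₀ (wt_pos σ k)]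
    have h2 : wt σ k = wt σ (k - s) * wt σ s := by rw [← wt_add, sub_add_cancel]
    rw [h2, ← mul_assoc, mul_comm (wt σ s)]
    exact mul_le_mul_of_nonneg_right (hC _) (wt_pos σ s).le
  calc PAdicFuchs.conv (PAdicFuchs.conv f g) h k
      = ∑' s, ∑' i, f i * g (s - i) * h (k - s) := by
        simp only [PAdicFuchs.conv]
        exact tsum_congr fun s => tsum_mul_right.symm
    _ = ∑' i, ∑' s, f i * g (s - i) * h (k - s) := hs.tsum_comm.symm
    _ = PAdicFuchs.conv f (PAdicFuchs.conv g h) k := by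
        simp only [PAdicFuchs.conv]
        refine tsum_congr fun i => ?_
        rw [← tsum_mul_left, ← (Equiv.addLeft i).tsum_eq]
        exact tsum_congr fun j => by
          simp only [Equiv.coe_addLeft, add_sub_cancel_left, sub_add_eq_sub_sub]
          ring

end Convolution

/-- Laurent series which converge at all polyradii in some member of the filter `F`. -/
def laurentSubmodule (K : Type u) [NontriviallyNormedField K] {n : ℕ} (F : Filter (Radii n)) :
    Submodule K ((Fin n → ℤ) → K) where
  carrier := {f | ∀ᶠ σ in F, Decays f σ}
  add_mem' hf hg := by
    filter_upwards [hf, hg] with σ h1 h2 using h1.add h2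
  zero_mem' := Eventually.of_forall fun _ => Decays.zero
  smul_mem' c f hf := by
    filter_upwards [hf] with σ h1 using h1.smul c

/-- The ring of Laurent series converging at all polyradii in some member of the filter `F`.
For `F = 𝓟 I` this is the ring `K_{I,n}` of functions on the polyannulus with radii in `I`;
for `F = 𝓝 ρ` it is the ring `R_ρ` (see `mem_laurentSubmodule_nhds`). -/
def Laurent (K : Type u) [NontriviallyNormedField K] {n : ℕ} (F : Filter (Radii n)) : Type u :=
  ↥(laurentSubmodule K F)

namespace Laurent

section Ring

variable {K : Type u} [NontriviallyNormedField K] {n : ℕ} {F G : Filter (Radii n)}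

/-- The additive group structure (not an instance: the one below the ring structure is used). -/
abbrev addGroupAux : AddCommGroup (Laurent K F) :=
  inferInstanceAs (AddCommGroup ↥(laurentSubmodule K F))

theorem ext_val {f g : Laurent K F} (h : f.1 = g.1) : f = g := Subtype.ext h

variable [CompleteSpace K] [IsUltrametricDist K]

variable [F.NeBot] [G.NeBot]

theorem exists_decays (f g h : Laurent K F) :
    ∃ σ, Decays f.1 σ ∧ Decays g.1 σ ∧ Decays h.1 σ :=
  (Eventually.and f.2 (Eventually.and g.2 h.2)).exists

instance : CommRing (Laurent K F) :=
  { (addGroupAux : AddCommGroup (Laurent K F)) with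
    mul := fun f g =>
      ⟨conv f.1 g.1, by filter_upwards [f.2, g.2] with σ h1 h2 using h1.conv h2⟩
    one := ⟨Pi.single 0 1, Eventually.of_forall fun _ => Decays.single 0 1⟩
    mul_assoc := fun f g h => by
      obtain ⟨σ, h1, h2, h3⟩ := exists_decays f g h
      exact ext_val (conv_assoc h1 h2 h3)
    mul_comm := fun f g => ext_val (conv_comm _ _)
    one_mul := fun f => ext_val (one_conv _)
    mul_one := fun f => ext_val ((conv_comm _ _).trans (one_conv _))
    left_distrib := fun f g h => by
      obtain ⟨σ, h1, h2, h3⟩ := exists_decays f g h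
      exact ext_val (conv_add h1 h2 h3)
    right_distrib := fun f g h => by
      obtain ⟨σ, h1, h2, h3⟩ := exists_decays f g h
      refine ext_val ?_
      change conv (f.1 + g.1) h.1 = conv f.1 h.1 + conv g.1 h.1
      rw [conv_comm, conv_add h3 h1 h2, conv_comm, conv_comm h.1]
    zero_mul := fun f => ext_val (by
      funext k
      change ∑' i, (0 : K) * _ = 0
      simp)
    mul_zero := fun f => ext_val (by
      funext k
      change ∑' i, _ * (0 : K) = 0
      simp) }

/-- The `K`-module structure (not an instance: the one below the algebra structure is used). -/
abbrev moduleAux : Module K (Laurent K F) :=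
  inferInstanceAs (Module K ↥(laurentSubmodule K F))

instance : Algebra K (Laurent K F) :=
  letI : Module K (Laurent K F) := moduleAux
  Algebra.ofModule (fun c f g => ext_val (smul_conv c _ _))
    (fun c f g => ext_val (by
      change conv f.1 (c • g.1) = c • conv f.1 g.1
      rw [conv_comm, smul_conv, conv_comm]))

/-- The linear map sending a Laurent series to its family of coefficients. -/
def coeffs : Laurent K F →ₗ[K] ((Fin n → ℤ) → K) where
  toFun f := f.1
  map_add' _ _ := rfl
  map_smul' _ _ := rfl

theorem coeffs_decays (f : Laurent K F) : ∀ᶠ σ in F, Decays (coeffs f) σ := f.2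

theorem ext_coeffs {f g : Laurent K F} (h : coeffs f = coeffs g) : f = g := Subtype.ext h

theorem coeffs_mul (f g : Laurent K F) : coeffs (f * g) = conv (coeffs f) (coeffs g) := rfl

theorem coeffs_one : coeffs (1 : Laurent K F) = Pi.single 0 1 := rfl

/-- The inclusion of rings of Laurent series when the domain shrinks. -/
def incl (h : F ≤ G) : Laurent K G →ₐ[K] Laurent K F :=
  AlgHom.ofLinearMap
    { toFun := fun f => ⟨coeffs f, h f.2⟩
      map_add' := fun _ _ => rfl
      map_smul' := fun _ _ => rfl }
    rfl (fun _ _ => rfl)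

/-- The part of a Laurent series supported on the exponents in `T`. -/
def restrict (T : Set (Fin n → ℤ)) : Laurent K F →ₗ[K] Laurent K F where
  toFun f := ⟨T.indicator (coeffs f), by
    filter_upwards [f.2] with σ h
    refine squeeze_zero (fun i => mul_nonneg (norm_nonneg _) (wt_pos σ i).le) (fun i => ?_) h
    exact mul_le_mul_of_nonneg_right (norm_indicator_le_norm_self _ _) (wt_pos σ i).le⟩
  map_add' f g := ext_coeffs (Set.indicator_add T _ _)
  map_smul' c f := ext_coeffs (Set.indicator_const_smul T c _)

end Ring

end Laurent

/-- A closed polysegment `[α, β]` of `ℝ_{>0}^n` containing `ρ` in its interior. -/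
structure Polysegment {n : ℕ} (ρ : Radii n) where
  lo : Radii n
  hi : Radii n
  lo_lt : ∀ i, lo i < ρ i
  lt_hi : ∀ i, ρ i < hi i

namespace Polysegment

variable {n : ℕ} {ρ : Radii n}

/-- The underlying set `∏ [α_i, β_i]`. -/
def toSet (J : Polysegment ρ) : Set (Radii n) := Set.Icc J.lo J.hi

theorem mem_toSet (J : Polysegment ρ) : ρ ∈ J.toSet :=
  ⟨fun i => (J.lo_lt i).le, fun i => (J.lt_hi i).le⟩

instance (J : Polysegment ρ) : (𝓟 J.toSet).NeBot := principal_neBot_iff.2 ⟨ρ, J.mem_toSet⟩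

theorem nhds_le (J : Polysegment ρ) : 𝓝 ρ ≤ 𝓟 J.toSet := by
  rw [le_principal_iff, toSet, ← Set.pi_univ_Icc]
  exact set_pi_mem_nhds Set.finite_univ fun i _ => Icc_mem_nhds (J.lo_lt i) (J.lt_hi i)

end Polysegment

/-- `R_ρ` is the directed union of the rings `K_{J,n}`. -/
theorem mem_laurentSubmodule_nhds {K : Type u} [NontriviallyNormedField K] {n : ℕ} {ρ : Radii n}
    {f : (Fin n → ℤ) → K} :
    f ∈ laurentSubmodule K (𝓝 ρ) ↔ ∃ J : Polysegment ρ, f ∈ laurentSubmodule K (𝓟 J.toSet) := by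
  refine ⟨fun h => ?_, fun ⟨J, h⟩ => J.nhds_le h⟩
  have h' : {σ | Decays f σ} ∈ 𝓝 ρ := h
  rw [nhds_pi, mem_pi] at h'
  obtain ⟨I, -, t, ht, hsub⟩ := h'
  have key : ∀ i, ∃ a b : Set.Ioi (0 : ℝ), a < ρ i ∧ ρ i < b ∧ Set.Icc a b ⊆ t i := by
    intro i
    obtain ⟨b', hb'⟩ := exists_gt (ρ i)
    obtain ⟨a', ha'⟩ := exists_lt (ρ i)
    obtain ⟨a, b, hab, hs⟩ := (mem_nhds_iff_exists_Ioo_subset' ⟨a', ha'⟩ ⟨b', hb'⟩).1 (ht i)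
    obtain ⟨a₁, h1, h2⟩ := exists_between hab.1
    obtain ⟨b₁, h3, h4⟩ := exists_between hab.2
    exact ⟨a₁, b₁, h2, h3, fun x hx => hs ⟨h1.trans_le hx.1, hx.2.trans_lt h4⟩⟩
  choose a b ha hb hab using key
  refine ⟨⟨a, b, ha, hb⟩, fun σ hσ => hsub fun i _ => hab i ⟨hσ.1 i, hσ.2 i⟩⟩

/-- The ring `R_ρ` of germs of Laurent series. -/
abbrev GermRing (K : Type u) [NontriviallyNormedField K] {n : ℕ} (ρ : Radii n) : Type u :=
  Laurent K (𝓝 ρ)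

/-- The ring `K_{[α,β],n}`. -/
abbrev SegRing (K : Type u) [NontriviallyNormedField K] {n : ℕ} {ρ : Radii n}
    (J : Polysegment ρ) : Type u :=
  Laurent K (𝓟 J.toSet)

instance {K : Type u} [NontriviallyNormedField K] [CompleteSpace K] [IsUltrametricDist K] {n : ℕ}
    {ρ : Radii n} (J : Polysegment ρ) : Algebra (SegRing K J) (GermRing K ρ) :=
  (Laurent.incl J.nhds_le).toRingHom.toAlgebra

instance {K : Type u} [NontriviallyNormedField K] [CompleteSpace K] [IsUltrametricDist K] {n : ℕ}
    {ρ : Radii n} (J : Polysegment ρ) : IsScalarTower K (SegRing K J) (GermRing K ρ) :=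
  IsScalarTower.of_algebraMap_eq fun c => ((Laurent.incl J.nhds_le).commutes c).symm

/-! ### Roots of unity -/

/-- The field `K(Γ)` generated over `K` by the roots of unity of `p`-power order in `K^alg`. -/
abbrev KGam (K : Type u) [Field K] (p : ℕ) : IntermediateField K (AlgebraicClosure K) :=
  IntermediateField.adjoin K {x | ∃ s : ℕ, x ^ p ^ s = 1}

/-- The group `Γ` of roots of unity of `p`-power order. -/
def Gam (K : Type u) [Field K] (p : ℕ) : Subgroup (KGam K p)ˣ where
  carrier := {x | ∃ s : ℕ, x ^ p ^ s = 1}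
  one_mem' := ⟨0, one_pow _⟩
  mul_mem' := by
    rintro x y ⟨s, hs⟩ ⟨r, hr⟩
    refine ⟨s + r, ?_⟩
    rw [mul_pow, pow_add, pow_mul, hs, one_pow, one_mul, mul_comm, pow_mul, hr, one_pow]
  inv_mem' := by
    rintro x ⟨s, hs⟩
    exact ⟨s, by rw [inv_pow, hs, inv_one]⟩

namespace Gam

variable {K : Type u} [Field K] {p : ℕ}

/-- An element of `Γ` seen in `K(Γ)`. -/
def val (z : Gam K p) : KGam K p := ((z : (KGam K p)ˣ) : KGam K p)

/-- The Galois action on `Γ`. -/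
def gal (τ : KGam K p ≃ₐ[K] KGam K p) (z : Gam K p) : Gam K p :=
  ⟨Units.map (τ : KGam K p →* KGam K p) z, by
    obtain ⟨s, hs⟩ := z.2
    exact ⟨s, by rw [← map_pow, hs, map_one]⟩⟩

open Classical in
/-- The power `z^a` of `z ∈ Γ` with exponent a `p`-adic integer: if `z^{p^s} = 1`, then `z^a` is
`z^b` for any integer `b ≡ a` modulo `p^s`. -/
def padicPow [Fact p.Prime] (z : Gam K p) (a : ℤ_[p]) : Gam K p :=
  z ^ (PadicInt.toZModPow (Nat.find z.2) a).val

/-- The character `i ↦ ζ^i = ζ_1^{i_1} ⋯ ζ_n^{i_n}` of `ℤ^n` given by `ζ ∈ Γ^n`. -/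
def char {n : ℕ} (ζ : Fin n → Gam K p) (i : Fin n → ℤ) : KGam K p := val (∏ j, ζ j ^ i j)

theorem finite_range_char [Fact p.Prime] {n : ℕ} (ζ : Fin n → Gam K p) :
    (Set.range (char ζ)).Finite := by
  choose s hs using fun j => (ζ j).2
  have hle : ∀ j, s j ≤ ∑ j, s j := fun j => Finset.single_le_sum (by simp) (Finset.mem_univ j)
  have hpos : 0 < p ^ ∑ j, s j := pow_pos (Fact.out : p.Prime).pos _
  refine (Polynomial.nthRootsFinset (p ^ ∑ j, s j) (1 : KGam K p)).finite_toSet.subset ?_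
  rintro _ ⟨i, rfl⟩
  rw [Finset.mem_coe, Polynomial.mem_nthRootsFinset hpos]
  have h1 : ∀ j, ζ j ^ p ^ (∑ j, s j) = 1 := fun j => by
    apply Subtype.ext
    rw [← Nat.sub_add_cancel (hle j), pow_add, mul_comm, pow_mul]
    simp only [Subgroup.coe_pow, Subgroup.coe_one]
    rw [hs, one_pow]
  have h2 : (∏ j, ζ j ^ i j) ^ p ^ (∑ j, s j) = 1 := by
    rw [← Finset.prod_pow]
    refine Finset.prod_eq_one fun j _ => ?_
    rw [← zpow_natCast, ← zpow_mul, mul_comm, zpow_mul, zpow_natCast, h1, one_zpow]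
  have h3 := congrArg val h2
  simpa [char, val] using h3

end Gam

/-! ### Extension of scalars to `K(Γ)` -/

section Scalars

variable {K : Type u} [NontriviallyNormedField K] [CompleteSpace K] [IsUltrametricDist K]
  {p : ℕ} {n : ℕ} {F : Filter (Radii n)} [F.NeBot]

/-- The `i`-th coefficient of an element of `Laurent K F ⊗ K(Γ)`, seen as a Laurent series
over `K(Γ)`. -/
def coeffGam (i : Fin n → ℤ) : Laurent K F ⊗[K] KGam K p →ₗ[K] KGam K p :=
  TensorProduct.lift ((LinearMap.lsmul K (KGam K p)).comp
    ((LinearMap.proj i).comp Laurent.coeffs))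

/-- The action `ζ^*(f(t)) = f(ζ t)` of `ζ ∈ Γ^n` on `Laurent K F ⊗ K(Γ)`: it sends
`f ⊗ a` to `∑_c f_c ⊗ c a`, where `c` runs over the finitely many values of `ζ^i` and `f_c` is the
part of `f` with exponents `i` such that `ζ^i = c` (see `coeffGam_twist`). -/
def twist [Fact p.Prime] (ζ : Fin n → Gam K p) :
    Laurent K F ⊗[K] KGam K p →ₗ[K] Laurent K F ⊗[K] KGam K p :=
  ∑ c ∈ (Gam.finite_range_char ζ).toFinset,
    TensorProduct.map (Laurent.restrict {i | Gam.char ζ i = c}) (LinearMap.mulLeft K c)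

theorem coeffGam_twist [Fact p.Prime] (ζ : Fin n → Gam K p) (i : Fin n → ℤ)
    (f : Laurent K F ⊗[K] KGam K p) :
    coeffGam i (twist ζ f) = Gam.char ζ i * coeffGam i f := by
  classical
  induction f with
  | zero => simp
  | add x y hx hy => rw [map_add, map_add, map_add, hx, hy, mul_add]
  | tmul g a =>
    have h1 : ∀ c : KGam K p, coeffGam i
        (TensorProduct.map (Laurent.restrict {i | Gam.char ζ i = c}) (LinearMap.mulLeft K c)
          (g ⊗ₜ[K] a)) = if Gam.char ζ i = c then Gam.char ζ i * coeffGam i (g ⊗ₜ[K] a) else 0 := by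
      intro c
      change (Set.indicator {i | Gam.char ζ i = c} (Laurent.coeffs g) i) • (c * a) =
        if Gam.char ζ i = c then Gam.char ζ i * (Laurent.coeffs g i • a) else 0
      rw [Set.indicator_apply]
      split_ifs with h h' h'
      · rw [← h', mul_smul_comm]
      · exact absurd h h'
      · exact absurd h' h
      · exact zero_smul _ _
    rw [twist, LinearMap.sum_apply, map_sum]
    simp only [h1]
    rw [Finset.sum_ite_eq, if_pos]
    simp

/-- The action of `Laurent K F ⊗ K(Γ)` on `M ⊗ K(Γ)`, `(f ⊗ a) • (x ⊗ b) = f x ⊗ a b`. -/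
def extSmul {M : Type v} [AddCommGroup M] [Module K M] [Module (Laurent K F) M]
    [IsScalarTower K (Laurent K F) M] :
    Laurent K F ⊗[K] KGam K p →ₗ[K] M ⊗[K] KGam K p →ₗ[K] M ⊗[K] KGam K p :=
  TensorProduct.map₂ (Algebra.lsmul K K M).toLinearMap (LinearMap.mul K (KGam K p))

/-- The supremum norm `|f|_J` of `f ∈ K_{J,n}`: the supremum over `σ ∈ J` of the `σ`-Gauss norms
`sup_i |f_i| σ^i`. -/
def segNorm {ρ : Radii n} {J : Polysegment ρ} (f : SegRing K J) : ℝ :=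
  ⨆ σ : J.toSet, ⨆ i : Fin n → ℤ, ‖Laurent.coeffs f i‖ * wt σ i

/-- The supremum norm `|f|_J` of `f ∈ K_{J,n} ⊗ K(Γ)`, where `K(Γ)` carries the unique norm
extending the one of `K`. -/
def segNormGam {ρ : Radii n} {J : Polysegment ρ} (f : SegRing K J ⊗[K] KGam K p) : ℝ :=
  ⨆ σ : J.toSet, ⨆ i : Fin n → ℤ, spectralNorm K (KGam K p) (coeffGam i f) * wt σ i

end Scalars

/-! ### The category `𝒞_ρ` -/

/-- A finite free module `M` over `Laurent K F` with a semilinear action of the group `Γ^n`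
on `M ⊗_K K(Γ)`. -/
structure GammaModule (K : Type u) [NontriviallyNormedField K] [CompleteSpace K]
    [IsUltrametricDist K] (p : ℕ) [Fact p.Prime] {n : ℕ} (F : Filter (Radii n)) [F.NeBot] where
  carrier : Type v
  [addCommGroup : AddCommGroup carrier]
  [moduleK : Module K carrier]
  [module : Module (Laurent K F) carrier]
  [tower : IsScalarTower K (Laurent K F) carrier]
  [finite : Module.Finite (Laurent K F) carrier]
  [free : Module.Free (Laurent K F) carrier]
  act : (Fin n → Gam K p) →* AddMonoid.End (carrier ⊗[K] KGam K p)
  semilinear : ∀ (ζ : Fin n → Gam K p) (f : Laurent K F ⊗[K] KGam K p)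
    (x : carrier ⊗[K] KGam K p), act ζ (extSmul f x) = extSmul (twist ζ f) (act ζ x)

attribute [instance] GammaModule.addCommGroup GammaModule.moduleK GammaModule.module
  GammaModule.tower GammaModule.finite GammaModule.free

section Category

variable {K : Type u} [NontriviallyNormedField K] [CompleteSpace K] [IsUltrametricDist K]
  {p : ℕ} [Fact p.Prime] {n : ℕ} {ρ : Radii n}

/-- The matrix `E` represents `ζ^*` in the basis `e`: `ζ^*(e_j ⊗ 1) = ∑_i E_{ij} (e_i ⊗ 1)`. -/
def Represents {F : Filter (Radii n)} [F.NeBot] (M : GammaModule.{u, v} K p F) {m : ℕ}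
    (e : Module.Basis (Fin m) (Laurent K F) M.carrier) (ζ : Fin n → Gam K p)
    (E : Matrix (Fin m) (Fin m) (Laurent K F ⊗[K] KGam K p)) : Prop :=
  ∀ j, M.act ζ (e j ⊗ₜ[K] 1) = ∑ i, extSmul (E i j) (e i ⊗ₜ[K] 1)

/-- The group `Γ_k^n`. -/
def GamLevel (K : Type u) [Field K] (p n k : ℕ) : Set (Fin n → Gam K p) :=
  {ζ | ∀ j, ζ j ^ p ^ k = 1}

/-- The `K`-linear map `P' → P` attached to an isomorphism `R_ρ ⊗ P' ≃ P`. -/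
def extMap {J : Polysegment ρ} {P' P : Type v} [AddCommGroup P'] [Module K P']
    [Module (SegRing K J) P'] [IsScalarTower K (SegRing K J) P'] [AddCommGroup P] [Module K P]
    [Module (GermRing K ρ) P] [IsScalarTower K (GermRing K ρ) P]
    (Φ : GermRing K ρ ⊗[SegRing K J] P' ≃ₗ[GermRing K ρ] P) : P' →ₗ[K] P where
  toFun x := Φ (1 ⊗ₜ x)
  map_add' x y := by rw [TensorProduct.tmul_add, map_add]
  map_smul' c x := by
    rw [RingHom.id_apply, ← algebraMap_smul (SegRing K J) c x, ← TensorProduct.smul_tmul,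
      ← algebraMap_smul (GermRing K ρ) c (Φ _), ← map_smul, TensorProduct.smul_tmul',
      IsScalarTower.algebraMap_apply K (SegRing K J) (GermRing K ρ), Algebra.smul_def,
      smul_eq_mul]

/-- A finite free `K_{J,n}`-module `P'`, with a semilinear action of `Γ^n` on `P' ⊗ K(Γ)`,
by which `P` is defined over `J`: `P` and its action are induced from `P'`, and
in some basis of `P'` the matrices of the elements of `Γ_k^n` have norm at most `p^{lk}`. -/
structure Model (P : GammaModule.{u, v} K p (𝓝 ρ)) where
  J : Polysegment ρ
  P' : GammaModule.{u, v} K p (𝓟 J.toSet)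
  iso : GermRing K ρ ⊗[SegRing K J] P'.carrier ≃ₗ[GermRing K ρ] P.carrier
  act_comm : ∀ (ζ : Fin n → Gam K p) (x : P'.carrier ⊗[K] KGam K p),
    P.act ζ (TensorProduct.map (extMap iso) LinearMap.id x) =
      TensorProduct.map (extMap iso) LinearMap.id (P'.act ζ x)
  bounded : ∃ (m : ℕ) (e : Module.Basis (Fin m) (SegRing K J) P'.carrier) (l : ℝ), 0 < l ∧
    ∀ k : ℕ, 0 < k → ∀ ζ ∈ GamLevel K p n k,
      ∃ E : Matrix (Fin m) (Fin m) (SegRing K J ⊗[K] KGam K p), Represents P' e ζ E ∧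
        ∀ i j, segNormGam (E i j) ≤ (p : ℝ) ^ (l * k)

variable (K p ρ) in
/-- The objects of the category `𝒞_ρ`. -/
structure Crho extends GammaModule.{u, v} K p (𝓝 ρ) where
  exists_model : Nonempty (Model toGammaModule)
  galois : ∀ (τ : KGam K p ≃ₐ[K] KGam K p) (ζ : Fin n → Gam K p) (x : carrier ⊗[K] KGam K p),
    TensorProduct.map LinearMap.id τ.toLinearMap (act ζ x) =
      act (fun j => Gam.gal τ (ζ j)) (TensorProduct.map LinearMap.id τ.toLinearMap x)

/-- The `n`-tuple `A` of diagonal matrices over `ℤ_p` is an exponent of `P`, admitted by the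
model `M` of `P`, with respect to the basis `e` of `M.P'`. -/
def Model.IsExponent {P : GammaModule.{u, v} K p (𝓝 ρ)} (M : Model P) {m : ℕ}
    (e : Module.Basis (Fin m) (SegRing K M.J) M.P'.carrier)
    (A : Fin n → Matrix (Fin m) (Fin m) ℤ_[p]) : Prop :=
  (∀ r, (A r).IsDiag) ∧
  ∃ S : ℕ → Matrix (Fin m) (Fin m) (SegRing K M.J),
    (∀ k : ℕ, 0 < k → ∀ ζ ∈ GamLevel K p n k, ∀ j,
      M.P'.act ζ ((∑ i, S k i j • e i) ⊗ₜ[K] 1) =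
        (∑ i, S k i j • e i) ⊗ₜ[K] Gam.val (∏ r, Gam.padicPow (ζ r) (A r j j))) ∧
    (∃ l : ℝ, 0 < l ∧ ∀ k : ℕ, 0 < k → ∀ i j, segNorm (S k i j) ≤ (p : ℝ) ^ (l * k)) ∧
    (∀ k : ℕ, 0 < k → 1 ≤ segNorm (S k).det)

/-- `A` is an exponent of `P`: it is admitted by some model of `P`. -/
def Crho.IsExponent (P : Crho.{u, v} K p ρ) {m : ℕ}
    (A : Fin n → Matrix (Fin m) (Fin m) ℤ_[p]) : Prop :=
  ∃ (M : Model P.toGammaModule) (e : Module.Basis (Fin m) (SegRing K M.J) M.P'.carrier),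
    M.IsExponent e A

end Category

end PAdicFuchs

end

/-!
Let `Γ_k^n` act on `P' ⊗ K(Γ)`. As `Γ_k^n` is a finite group of order prime to the characteristic
of `K`, the space `P' ⊗ K(Γ)` is the direct sum of its isotypic parts, with projections
`π_{k,a} = p^{-kn} ∑_ζ ζ^{-a} ζ^*` for `a ∈ (ℤ/p^k)^n`. These commute with the Galois action, so by
Galois descent they map `P'` to itself.

Given tuples `a_1, …, a_m` modulo `p^k` such that `|det(π_{k,a_j} e_j)_j| ≥ 1`, write each
`π_{k,a_j}` as the sum of the `π_{k+1,b}` over the `p^n` lifts `b` of `a_j` modulo `p^{k+1}`. The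
determinant is multilinear and the norm is ultrametric, so for some choice of lifts `b_j` the
vectors `π_{k+1,b_j} e_j` again have a determinant of norm at least `1`. Starting from the basis
itself, where `k = 0`, this yields compatible tuples, whose `p`-adic limit is the exponent. The
bound on the entries is immediate from the formula for `π_{k,a}` and the bound on the action.

The exponent does not depend on the basis: passing to another one changes the determinants by a
fixed factor, which is compensated by multiplying all vectors by a large enough scalar.
-/

noncomputable section

open Filter Topology TensorProduct

namespace PAdicFuchs

universe u v

/-! ### Galois descent along `K(Γ)/K` -/

theorem isGalois_KGam {K : Type u} [Field K] {p : ℕ} (hp : (p : K) ≠ 0) :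
    IsGalois K (KGam K p) := by
  let S : Set ℕ := Set.range fun s => p ^ s
  have hS : ∀ N ∈ S, N ≠ 0 → ∃ r : AlgebraicClosure K, IsPrimitiveRoot r N := by
    rintro _ ⟨s, rfl⟩ -
    have : NeZero ((p ^ s : ℕ) : AlgebraicClosure K) := ⟨by
      rw [Nat.cast_pow, ← map_natCast (algebraMap K (AlgebraicClosure K))]
      exact pow_ne_zero s ((map_ne_zero _).2 hp)⟩
    exact HasEnoughRootsOfUnity.exists_primitiveRoot _ _
  have hp0 : p ≠ 0 := fun h => hp (by simp [h])
  have hset : {x : AlgebraicClosure K | ∃ s : ℕ, x ^ p ^ s = 1} =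
      {x | ∃ N ∈ S, N ≠ 0 ∧ x ^ N = 1} := by
    ext x
    simp [S, hp0]
  have := IntermediateField.isCyclotomicExtension_adjoin_of_exists_isPrimitiveRoot S K _ hS
  rw [KGam, hset]
  exact IsCyclotomicExtension.isGalois S K _

section RightModule

variable {K : Type u} [Field K] {L : Type*} [Field L] [Algebra K L] {M N : Type*}
  [AddCommGroup M] [Module K M] [AddCommGroup N] [Module K N]

/-- The `L`-vector space structure on `M ⊗[K] L` given by multiplication on the right factor.
(Mathlib lets scalars act on the left factor of a tensor product.) -/
abbrev rightModule : Module L (M ⊗[K] L) := (TensorProduct.comm K M L).toAddEquiv.module L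

attribute [local instance] rightModule

theorem smul_tmul_right (a : L) (x : M) (b : L) : a • (x ⊗ₜ[K] b) = x ⊗ₜ[K] (a * b) := rfl

theorem algebraMap_smul_right (c : K) (x : M ⊗[K] L) : algebraMap K L c • x = c • x := by
  induction x with
  | zero => simp
  | add x y hx hy => rw [smul_add, smul_add, hx, hy]
  | tmul x b => rw [smul_tmul_right, TensorProduct.smul_tmul', TensorProduct.smul_tmul,
      Algebra.smul_def]

theorem map_smul_right (f : M →ₗ[K] N) (τ : L →ₐ[K] L) (a : L) (x : M ⊗[K] L) :
    TensorProduct.map f τ.toLinearMap (a • x) = τ a • TensorProduct.map f τ.toLinearMap x := by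
  induction x with
  | zero => simp
  | add x y hx hy => rw [smul_add, map_add, map_add, smul_add, hx, hy]
  | tmul x b => simp [smul_tmul_right]

/-- The `L`-linear map `f ⊗ L : M ⊗[K] L → N ⊗[K] L`. -/
def rTensorRight (f : M →ₗ[K] N) : M ⊗[K] L →ₗ[L] N ⊗[K] L :=
  { TensorProduct.map f LinearMap.id with
    map_smul' := map_smul_right f (AlgHom.id K L) }

variable (K L M) in
theorem tmul_one_injective : Function.Injective fun x : M => x ⊗ₜ[K] (1 : L) := fun _ _ h =>
  Module.Flat.tensorProduct_mk_injective (R := K) M L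
    ((TensorProduct.comm K M L).symm.injective h)

theorem exists_tmul_one_eq_of_fixed [IsGalois K L] (x : M ⊗[K] L)
    (hx : ∀ τ : L ≃ₐ[K] L, TensorProduct.map LinearMap.id τ.toLinearMap x = x) :
    ∃ y : M, y ⊗ₜ[K] 1 = x := by
  classical
  let b := Module.Basis.ofVectorSpace K M
  let φ := TensorProduct.equivFinsuppOfBasisLeft (N := L) b
  have hφ (τ : L ≃ₐ[K] L) (z : M ⊗[K] L) (i) :
      φ (TensorProduct.map LinearMap.id τ.toLinearMap z) i = τ (φ z i) := by
    induction z with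
    | zero => simp
    | add z w hz hw => simp only [map_add, Finsupp.add_apply, hz, hw]
    | tmul m a => simp [φ]
  have hfixed (i) : φ x i ∈ Set.range (algebraMap K L) :=
    (InfiniteGalois.mem_range_algebraMap_iff_fixed _).2 fun τ => by rw [← hφ, hx]
  choose c hc using hfixed
  let y : _ →₀ K := Finsupp.onFinset (φ x).support c fun i hi =>
    Finsupp.mem_support_iff.2 (by rwa [← hc, map_ne_zero])
  refine ⟨b.repr.symm y, φ.injective (Finsupp.ext fun i => ?_)⟩
  calc φ (b.repr.symm y ⊗ₜ 1) i = c i • (1 : L) := by simp [φ, y]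
    _ = φ x i := by rw [← Algebra.algebraMap_eq_smul_one, hc]

end RightModule

/-! ### Isotypic projections of representations -/

section IsotypicProj

variable {k G V : Type*} [Field k] [Group G] [AddCommGroup V] [Module k V]

/-- The operator `N⁻¹ ∑_{h ∈ H} χ(h)⁻¹ ρ(h)` attached to a finite subgroup `H`, a character `χ` and
a scalar `N`. When `N` is the order of `H` and is not zero in `k`, it is the projection to the
subspace on which `H` acts by `χ`. -/
def isotypicProj (ρ : Representation k G V) (H : Subgroup G) [Fintype H] (N : k) (χ : G →* k) :
    Module.End k V :=
  ∑ h : H, (N⁻¹ * χ (h : G)⁻¹) • ρ h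

variable (ρ : Representation k G V) {H : Subgroup G} [Fintype H]

theorem rep_apply_isotypicProj (N : k) (χ : G →* k) {g : G} (hg : g ∈ H) (x : V) :
    ρ g (isotypicProj ρ H N χ x) = χ g • isotypicProj ρ H N χ x := by
  simp only [isotypicProj, LinearMap.sum_apply, LinearMap.smul_apply, map_sum, map_smul,
    Finset.smul_sum]
  refine Fintype.sum_equiv (Equiv.mulLeft (⟨g, hg⟩ : H)) _ _ fun h => ?_
  have hcoeff : χ g * χ (g * h)⁻¹ = χ (h : G)⁻¹ := by
    rw [mul_inv_rev, map_mul, mul_left_comm, ← map_mul, mul_inv_cancel, map_one, mul_one]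
  rw [smul_smul, Equiv.coe_mulLeft, Subgroup.coe_mul, mul_left_comm, hcoeff, map_mul,
    Module.End.mul_apply]

theorem isotypicProj_of_forall_eq_one (hH : ∀ h ∈ H, h = 1) (χ : G →* k) :
    isotypicProj ρ H 1 χ = 1 := by
  have hH1 (h : H) : h = 1 := Subtype.ext (hH h h.2)
  rw [isotypicProj, Fintype.sum_eq_single 1 fun h hne => absurd (hH1 h) hne]
  simp

theorem sum_isotypicProj {H' : Subgroup G} [Fintype H'] (hHH' : H ≤ H') {ι : Type*} [Fintype ι]
    (N : k) (χ : G →* k) (χ' : ι → G →* k) {c : k} (hc : c ≠ 0) [DecidablePred (· ∈ H)]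
    (hχ : ∀ g ∈ H', ∑ i, χ' i g = if g ∈ H then c * χ g else 0) :
    ∑ i, isotypicProj ρ H' (c * N) (χ' i) = isotypicProj ρ H N χ := by
  classical
  have hcoeff (h : H') : ∑ i, ((c * N)⁻¹ * χ' i (h : G)⁻¹) • ρ h =
      if (h : G) ∈ H then (N⁻¹ * χ (h : G)⁻¹) • ρ h else 0 := by
    rw [← Finset.sum_smul, ← Finset.mul_sum, hχ _ (inv_mem h.2), mul_ite, mul_zero, ite_smul,
      zero_smul, mul_inv_rev, mul_assoc, inv_mul_cancel_left₀ hc]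
    simp only [inv_mem_iff]
  simp only [isotypicProj]
  rw [Finset.sum_comm, Finset.sum_congr rfl fun h _ => hcoeff h, ← Finset.sum_filter]
  exact (Finset.sum_bij (fun h _ => Subgroup.inclusion hHH' h) (by simp)
    (fun _ _ _ _ h => Subgroup.inclusion_injective hHH' h)
    (fun h hh => ⟨⟨h, (Finset.mem_filter.1 hh).2⟩, by simp, rfl⟩) fun h _ => rfl).symm

theorem map_isotypicProj {N : k} (χ : G →* k) {T : V →+ V} {σ : k →+* k} {φ : G ≃* G}
    (hTσ : ∀ (c : k) x, T (c • x) = σ c • T x) (hTρ : ∀ g x, T (ρ g x) = ρ (φ g) (T x))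
    (hN : σ N = N) (hχ : ∀ g, σ (χ g) = χ (φ g)) (hH : H.map φ.toMonoidHom = H) (x : V) :
    T (isotypicProj ρ H N χ x) = isotypicProj ρ H N χ (T x) := by
  simp only [isotypicProj, LinearMap.sum_apply, LinearMap.smul_apply, map_sum, hTσ, hTρ, map_mul,
    map_inv₀, hN, hχ, map_inv]
  exact Fintype.sum_equiv ((φ.subgroupMap H).trans (MulEquiv.subgroupCongr hH)).toEquiv _ _
    fun h => rfl

end IsotypicProj

theorem norm_apply_isotypicProj_le {k G V W : Type*} [NormedField k] [Group G] [AddCommGroup V]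
    [Module k V] [NormedAddCommGroup W] [NormedSpace k W] [IsUltrametricDist W]
    (ρ : Representation k G V) {H : Subgroup G} [Fintype H] (N : k) {χ : G →* k}
    (hχ : ∀ h ∈ H, ‖χ h‖ = 1) (f : V →ₗ[k] W) {x : V} {C : ℝ} (hC : 0 ≤ C)
    (hf : ∀ h ∈ H, ‖f (ρ h x)‖ ≤ C) : ‖f (isotypicProj ρ H N χ x)‖ ≤ ‖N‖⁻¹ * C := by
  rw [isotypicProj, LinearMap.sum_apply, map_sum]
  refine IsUltrametricDist.norm_sum_le_of_forall_le_of_nonneg (by positivity) fun h _ => ?_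
  rw [LinearMap.smul_apply, map_smul, norm_smul, norm_mul, hχ _ (inv_mem h.2), mul_one, norm_inv]
  gcongr
  exact hf h h.2

/-! ### Characters of `Γ^n` -/

theorem sum_pow_of_pow_eq_one {R : Type*} [CommRing R] [IsDomain R] [DecidableEq R] {x : R} {N : ℕ}
    (hx : x ^ N = 1) : ∑ c : Fin N, x ^ (c : ℕ) = if x = 1 then (N : R) else 0 := by
  rw [Fin.sum_univ_eq_sum_range fun c => x ^ c]
  split_ifs with h
  · simp [h]
  · have := mul_geom_sum x N
    rw [hx, sub_self] at this
    exact (mul_eq_zero.1 this).resolve_left (sub_ne_zero.2 h)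

namespace Gam

variable {K : Type u} [Field K] {p n : ℕ}

@[simp] theorem val_one : val (1 : Gam K p) = 1 := rfl

@[simp] theorem val_pow (z : Gam K p) (s : ℕ) : val (z ^ s) = val z ^ s := by simp [val]

theorem val_prod {ι : Type*} (s : Finset ι) (z : ι → Gam K p) :
    val (∏ i ∈ s, z i) = ∏ i ∈ s, val (z i) := by simp [val]

theorem val_injective : Function.Injective (val : Gam K p → KGam K p) := fun _ _ h =>
  Subtype.ext (Units.ext h)

/-- The Galois action `gal` on `Γ`, as an automorphism of groups. -/
def galEquiv (τ : KGam K p ≃ₐ[K] KGam K p) : Gam K p ≃* Gam K p where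
  toFun := gal τ
  invFun := gal τ.symm
  left_inv _ := val_injective (τ.symm_apply_apply _)
  right_inv _ := val_injective (τ.apply_symm_apply _)
  map_mul' _ _ := val_injective (map_mul τ _ _)

variable (n) in
/-- The group automorphism of `Γ^n` induced by the Galois action on `Γ`. -/
def galPi (τ : KGam K p ≃ₐ[K] KGam K p) : (Fin n → Gam K p) ≃* (Fin n → Gam K p) :=
  MulEquiv.piCongrRight fun _ => galEquiv τ

/-- The character `ζ ↦ ζ^a` of `Γ^n` given by `a ∈ ℤ^n`. -/
def charHom (a : Fin n → ℤ) : (Fin n → Gam K p) →* KGam K p where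
  toFun ζ := char ζ a
  map_one' := by simp [char]
  map_mul' ζ η := by simp [char, mul_zpow, Finset.prod_mul_distrib, val]

theorem char_zero (ζ : Fin n → Gam K p) : char ζ 0 = 1 := by simp [char]

theorem char_galPi (τ : KGam K p ≃ₐ[K] KGam K p) (ζ : Fin n → Gam K p) (a : Fin n → ℤ) :
    char (galPi n τ ζ) a = τ (char ζ a) := by
  change val (∏ j, galEquiv τ (ζ j) ^ a j) = val (galEquiv τ (∏ j, ζ j ^ a j))
  simp only [map_prod, map_zpow]

variable (K p n) in
/-- The group `Γ_k^n` as a subgroup of `Γ^n`; its underlying set is `GamLevel K p n k`. -/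
def level (k : ℕ) : Subgroup (Fin n → Gam K p) := (powMonoidHom (p ^ k)).ker

theorem mem_level {k : ℕ} {ζ : Fin n → Gam K p} : ζ ∈ level K p n k ↔ ζ ∈ GamLevel K p n k :=
  funext_iff

theorem eq_one_of_mem_level_zero {ζ : Fin n → Gam K p} (hζ : ζ ∈ level K p n 0) : ζ = 1 := by
  simpa [level] using hζ

theorem level_le_level_succ (k : ℕ) : level K p n k ≤ level K p n (k + 1) := fun ζ hζ => by
  rw [level, MonoidHom.mem_ker, powMonoidHom_apply] at *
  rw [pow_succ, pow_mul, hζ, one_pow]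

theorem map_level (φ : (Fin n → Gam K p) ≃* (Fin n → Gam K p)) (k : ℕ) :
    (level K p n k).map φ.toMonoidHom = level K p n k := by
  ext ζ
  rw [Subgroup.mem_map_equiv, level, MonoidHom.mem_ker, MonoidHom.mem_ker, powMonoidHom_apply,
    powMonoidHom_apply, ← map_pow, map_eq_one_iff _ φ.symm.injective]

theorem finite_gamLevel [Fact p.Prime] (k : ℕ) : (GamLevel K p n k).Finite := by
  have hroots : {z : Gam K p | z ^ p ^ k = 1}.Finite := by
    refine Set.Finite.of_finite_image (f := val) ?_ val_injective.injOn
    refine (Polynomial.nthRootsFinset (p ^ k) (1 : KGam K p)).finite_toSet.subset ?_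
    rintro _ ⟨z, hz, rfl⟩
    rw [Finset.mem_coe, Polynomial.mem_nthRootsFinset (pow_pos (Fact.out : p.Prime).pos _),
      ← val_pow, show z ^ p ^ k = 1 from hz, val_one]
  exact Set.Finite.pi' fun _ : Fin n => hroots

instance [Fact p.Prime] (k : ℕ) : Fintype (level K p n k) :=
  ((finite_gamLevel k).subset fun _ => mem_level.1).fintype

/-- The exponent `a + p^k b`. As `b` varies, these exponents represent the classes modulo `p^(k+1)`
which lift the class of `a` modulo `p^k`. -/
def lift (k : ℕ) (a : Fin n → ℤ) (b : Fin n → Fin p) : Fin n → ℤ :=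
  fun j => a j + (p : ℤ) ^ k * ((b j : ℕ) : ℤ)

theorem char_lift (k : ℕ) (a : Fin n → ℤ) (b : Fin n → Fin p) (ζ : Fin n → Gam K p) :
    char ζ (lift k a b) = char ζ a * ∏ j, val (ζ j ^ p ^ k) ^ (b j : ℕ) := by
  have hζ (j : Fin n) : ζ j ^ lift k a b j = ζ j ^ a j * (ζ j ^ p ^ k) ^ (b j : ℕ) := by
    rw [lift, zpow_add, ← pow_mul, ← zpow_natCast _ (_ * _)]
    push_cast
    rfl
  simp only [char, hζ, val_prod, ← val_pow, Finset.prod_mul_distrib]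
  simp only [← val_prod]
  rfl

theorem sum_char_lift [Fact p.Prime] (k : ℕ) (a : Fin n → ℤ) {ζ : Fin n → Gam K p}
    (hζ : ζ ∈ level K p n (k + 1)) [Decidable (ζ ∈ level K p n k)] :
    ∑ b : Fin n → Fin p, char ζ (lift k a b) =
      if ζ ∈ level K p n k then (p : KGam K p) ^ n * char ζ a else 0 := by
  classical
  have hroot (j : Fin n) : val (ζ j ^ p ^ k) ^ p = 1 := by
    rw [← val_pow, ← pow_mul, ← pow_succ, mem_level.1 hζ j, val_one]
  have hone (j : Fin n) : val (ζ j ^ p ^ k) = 1 ↔ ζ j ^ p ^ k = 1 := val_injective.eq_iff' val_one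
  calc ∑ b : Fin n → Fin p, char ζ (lift k a b)
      = char ζ a * ∏ j, ∑ c : Fin p, val (ζ j ^ p ^ k) ^ (c : ℕ) := by
        simp only [char_lift, ← Finset.mul_sum, Finset.prod_univ_sum, Fintype.piFinset_univ]
    _ = char ζ a * ∏ j, if ζ j ^ p ^ k = 1 then (p : KGam K p) else 0 := by
        simp only [sum_pow_of_pow_eq_one (hroot _), hone]
    _ = if ζ ∈ level K p n k then (p : KGam K p) ^ n * char ζ a else 0 := by
        simp only [Finset.prod_ite_zero, Finset.mem_univ, true_imp_iff, Finset.prod_const,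
          Finset.card_univ, Fintype.card_fin, mul_ite, mul_zero]
        exact if_congr mem_level.symm (mul_comm _ _) rfl

theorem padicPow_eq_zpow [Fact p.Prime] {k : ℕ} {z : Gam K p} (hz : z ^ p ^ k = 1) {A : ℤ_[p]}
    {a : ℤ} (hA : PadicInt.toZModPow k A = a) : padicPow z A = z ^ a := by
  classical
  rw [padicPow]
  set s := Nat.find z.2
  have hsk : s ≤ k := Nat.find_min' z.2 (congrArg Subtype.val hz)
  have hzs : z ^ p ^ s = 1 := Subtype.ext (Nat.find_spec z.2)
  have hAs : PadicInt.toZModPow s A = a := by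
    rw [← PadicInt.cast_toZModPow s k hsk, hA]
    exact ZMod.cast_intCast (pow_dvd_pow p hsk) a
  have hval : (((PadicInt.toZModPow s A).val : ℤ) : ZMod (p ^ s)) = a := by simp [hAs]
  rw [← zpow_natCast, zpow_eq_zpow_iff_modEq]
  exact ((ZMod.intCast_eq_intCast_iff _ _ _).1 hval).of_dvd
    (Int.natCast_dvd_natCast.2 (orderOf_dvd_of_pow_eq_one hzs))

theorem val_prod_padicPow [Fact p.Prime] {k : ℕ} {ζ : Fin n → Gam K p} (hζ : ζ ∈ GamLevel K p n k)
    {A : Fin n → ℤ_[p]} {a : Fin n → ℤ} (hA : ∀ r, PadicInt.toZModPow k (A r) = a r) :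
    val (∏ r, padicPow (ζ r) (A r)) = char ζ a := by
  simp only [char, padicPow_eq_zpow (hζ _) (hA _)]

end Gam

theorem exists_padicInt_toZModPow_eq {p : ℕ} [Fact p.Prime] {a : ℕ → ℤ}
    (ha : ∀ k, (p : ℤ) ^ k ∣ a (k + 1) - a k) :
    ∃ A : ℤ_[p], ∀ k, PadicInt.toZModPow k A = a k :=
  ⟨_, PadicInt.toZModPow_ofIntSeq_of_pow_dvd_sub a p ha⟩

/-! ### Modules with an action of `Γ^n` -/

section Laurent

variable {K : Type u} [NontriviallyNormedField K] [CompleteSpace K] [IsUltrametricDist K]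
  {p n : ℕ} {F : Filter (Radii n)} [F.NeBot]

attribute [local instance] rightModule

instance : Nontrivial (Laurent K F) := ⟨⟨1, 0, fun h => by
  simpa [Laurent.coeffs_one] using congrFun (congrArg Laurent.coeffs h) 0⟩⟩

theorem Laurent.restrict_one (T : Set (Fin n → ℤ)) [Decidable (0 ∈ T)] :
    restrict T (1 : Laurent K F) = if 0 ∈ T then 1 else 0 := by
  classical
  apply ext_coeffs
  funext i
  change T.indicator (coeffs (1 : Laurent K F)) i = _
  rw [coeffs_one, Set.indicator_apply]
  by_cases hi : i = 0
  · subst hi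
    split_ifs <;> simp [coeffs_one]
  · split_ifs <;> simp [coeffs_one, hi]

theorem twist_one_tmul [Fact p.Prime] (ζ : Fin n → Gam K p) (a : KGam K p) :
    twist ζ ((1 : Laurent K F) ⊗ₜ[K] a) = 1 ⊗ₜ[K] a := by
  classical
  simp only [twist, LinearMap.sum_apply, TensorProduct.map_tmul, Laurent.restrict_one,
    Set.mem_ofPred_eq, Gam.char_zero]
  rw [Finset.sum_eq_single 1]
  · simp
  · intro c _ hc
    simp [hc.symm]
  · intro h
    exact absurd ((Gam.finite_range_char ζ).mem_toFinset.2 ⟨0, Gam.char_zero ζ⟩) h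

theorem extSmul_one_tmul {M : Type v} [AddCommGroup M] [Module K M] [Module (Laurent K F) M]
    [IsScalarTower K (Laurent K F) M] (a : KGam K p) (x : M ⊗[K] KGam K p) :
    extSmul ((1 : Laurent K F) ⊗ₜ[K] a) x = a • x := by
  induction x with
  | zero => simp
  | add x y hx hy => rw [map_add, hx, hy, smul_add]
  | tmul m b => simp [extSmul, smul_tmul_right]

end Laurent

namespace GammaModule

variable {K : Type u} [NontriviallyNormedField K] [CompleteSpace K] [IsUltrametricDist K]
  {p : ℕ} [Fact p.Prime] {n : ℕ} {F : Filter (Radii n)} [F.NeBot] (M : GammaModule.{u, v} K p F)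

attribute [local instance] rightModule

theorem act_smul (ζ : Fin n → Gam K p) (a : KGam K p) (x : M.carrier ⊗[K] KGam K p) :
    M.act ζ (a • x) = a • M.act ζ x := by
  rw [← extSmul_one_tmul (F := F), M.semilinear, twist_one_tmul, extSmul_one_tmul]

/-- The action of `Γ^n` on `M ⊗ K(Γ)` as a representation over `K(Γ)`. -/
def rep : Representation (KGam K p) (Fin n → Gam K p) (M.carrier ⊗[K] KGam K p) where
  toFun ζ := { M.act ζ with map_smul' := M.act_smul ζ }
  map_one' := LinearMap.ext fun x => DFunLike.congr_fun (map_one M.act) x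
  map_mul' ζ η := LinearMap.ext fun x => DFunLike.congr_fun (map_mul M.act ζ η) x

/-- The projection to the part of `M ⊗ K(Γ)` on which `Γ_k^n` acts by `ζ ↦ ζ^a`. The factor
`p^{kn}` is the order of `Γ_k^n`. -/
def proj (k : ℕ) (a : Fin n → ℤ) : Module.End (KGam K p) (M.carrier ⊗[K] KGam K p) :=
  isotypicProj M.rep (Gam.level K p n k) ((p : KGam K p) ^ (k * n)) (Gam.charHom a)

theorem proj_zero (a : Fin n → ℤ) : M.proj 0 a = 1 := by
  rw [proj, zero_mul, pow_zero]
  exact isotypicProj_of_forall_eq_one _ (fun _ => Gam.eq_one_of_mem_level_zero) _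

theorem act_proj {k : ℕ} (a : Fin n → ℤ) (x : M.carrier ⊗[K] KGam K p) {ζ : Fin n → Gam K p}
    (hζ : ζ ∈ Gam.level K p n k) : M.act ζ (M.proj k a x) = Gam.char ζ a • M.proj k a x :=
  rep_apply_isotypicProj M.rep _ (Gam.charHom a) hζ x

theorem sum_proj_lift (hp : (p : K) ≠ 0) (k : ℕ) (a : Fin n → ℤ) :
    ∑ b : Fin n → Fin p, M.proj (k + 1) (Gam.lift k a b) = M.proj k a := by
  classical
  have hp' : (p : KGam K p) ^ n ≠ 0 := by
    rw [← map_natCast (algebraMap K (KGam K p))]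
    exact pow_ne_zero n ((map_ne_zero _).2 hp)
  have hpow : (p : KGam K p) ^ ((k + 1) * n) = p ^ n * p ^ (k * n) := by ring
  simp only [proj, hpow]
  exact sum_isotypicProj M.rep (Gam.level_le_level_succ k) _ _ _ hp' fun _ hζ =>
    Gam.sum_char_lift k a hζ

/-- The compatibility of the action with the Galois action. -/
def GaloisCompatible : Prop :=
  ∀ (τ : KGam K p ≃ₐ[K] KGam K p) (ζ : Fin n → Gam K p) (x : M.carrier ⊗[K] KGam K p),
    TensorProduct.map LinearMap.id τ.toLinearMap (M.act ζ x) =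
      M.act (fun j => Gam.gal τ (ζ j)) (TensorProduct.map LinearMap.id τ.toLinearMap x)

variable {M}

theorem GaloisCompatible.map_proj (hM : M.GaloisCompatible) (k : ℕ) (a : Fin n → ℤ)
    (τ : KGam K p ≃ₐ[K] KGam K p) (x : M.carrier ⊗[K] KGam K p) :
    TensorProduct.map LinearMap.id τ.toLinearMap (M.proj k a x) =
      M.proj k a (TensorProduct.map LinearMap.id τ.toLinearMap x) := by
  have hsmul (c : KGam K p) (y : M.carrier ⊗[K] KGam K p) :
      TensorProduct.map LinearMap.id τ.toLinearMap (c • y) =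
        τ c • TensorProduct.map LinearMap.id τ.toLinearMap y :=
    map_smul_right LinearMap.id (τ : KGam K p →ₐ[K] KGam K p) c y
  exact map_isotypicProj M.rep (Gam.charHom a)
    (T := (TensorProduct.map LinearMap.id τ.toLinearMap).toAddMonoidHom)
    (σ := (τ : KGam K p →+* KGam K p)) (φ := Gam.galPi n τ) hsmul (hM τ) (by simp)
    (fun ζ => (Gam.char_galPi τ ζ a).symm) (Gam.map_level _ k) x

theorem GaloisCompatible.exists_tmul_one_eq_proj (hp : (p : K) ≠ 0) (hM : M.GaloisCompatible)
    (k : ℕ) (a : Fin n → ℤ) (x : M.carrier) :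
    ∃ y : M.carrier, y ⊗ₜ[K] 1 = M.proj k a (x ⊗ₜ[K] 1) := by
  have := isGalois_KGam hp
  refine exists_tmul_one_eq_of_fixed _ fun τ => ?_
  rw [hM.map_proj, TensorProduct.map_tmul]
  simp

end GammaModule

namespace Model

variable {K : Type u} [NontriviallyNormedField K] [CompleteSpace K] [IsUltrametricDist K]
  {p : ℕ} [Fact p.Prime] {n : ℕ} {ρ : Radii n} {P : GammaModule.{u, v} K p (𝓝 ρ)} (M : Model P)

theorem extMap_injective : Function.Injective (extMap M.iso) := by
  have hincl : Function.Injective (algebraMap (SegRing K M.J) (GermRing K ρ)) := fun _ _ h =>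
    Laurent.ext_coeffs (congrArg (Laurent.coeffs (F := 𝓝 ρ)) h)
  have : FaithfulSMul (SegRing K M.J) (GermRing K ρ) :=
    (faithfulSMul_iff_algebraMap_injective _ _).2 hincl
  exact fun x y h => Module.Flat.tensorProduct_mk_injective (R := SegRing K M.J)
    (S := GermRing K ρ) _ (M.iso.injective h)

theorem galoisCompatible (hP : P.GaloisCompatible) : M.P'.GaloisCompatible := by
  intro τ ζ x
  have hcomm (z : M.P'.carrier ⊗[K] KGam K p) :
      TensorProduct.map (extMap M.iso) LinearMap.id
          (TensorProduct.map LinearMap.id τ.toLinearMap z) =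
        TensorProduct.map LinearMap.id τ.toLinearMap
          (TensorProduct.map (extMap M.iso) LinearMap.id z) := by
    simp only [← LinearMap.comp_apply, ← TensorProduct.map_comp, LinearMap.comp_id,
      LinearMap.id_comp]
  apply Module.Flat.rTensor_preserves_injective_linearMap _ M.extMap_injective
  change TensorProduct.map (extMap M.iso) LinearMap.id _ =
    TensorProduct.map (extMap M.iso) LinearMap.id _
  rw [hcomm, ← M.act_comm, hP, ← M.act_comm, hcomm]

theorem finrank_eq : Module.finrank (GermRing K ρ) P.carrier =
    Module.finrank (SegRing K M.J) M.P'.carrier := by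
  rw [← M.iso.finrank_eq, Module.finrank_baseChange]

end Model

/-! ### The supremum norm -/

section Bounded

variable {n : ℕ} {ρ : Radii n}

/-- The vertices of the polysegment `[α, β]`: the `j`-th coordinate is `β_j` if `s j` is true
and `α_j` otherwise. -/
def Polysegment.vertex (J : Polysegment ρ) (s : Fin n → Bool) : Radii n :=
  fun j => if s j then J.hi j else J.lo j

variable {J : Polysegment ρ}

theorem Polysegment.vertex_mem (s : Fin n → Bool) : J.vertex s ∈ J.toSet := by
  have hJ (j) : J.lo j ≤ J.hi j := ((J.lo_lt j).trans (J.lt_hi j)).le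
  constructor <;> intro j <;> cases h : s j <;> simp [vertex, h, hJ j]

theorem Polysegment.wt_le_wt_vertex {σ : Radii n} (hσ : σ ∈ J.toSet) (i : Fin n → ℤ) :
    wt σ i ≤ wt (J.vertex fun j => 0 ≤ i j) i := by
  refine Finset.prod_le_prod (fun j _ => (zpow_pos (σ j).2 _).le) fun j _ => ?_
  have hlo : (J.lo j : ℝ) ≤ σ j := hσ.1 j
  have hhi : (σ j : ℝ) ≤ J.hi j := hσ.2 j
  rw [vertex]
  rcases le_or_gt 0 (i j) with hi | hi
  · simpa [hi] using zpow_le_zpow_left₀ hi (σ j).2.le hhi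
  · simpa [hi.not_ge] using inv_anti₀ (zpow_pos (J.lo j).2 _)
      (zpow_le_zpow_left₀ (neg_nonneg.2 hi.le) (J.lo j).2.le hlo)

/-- The condition that the Gauss norms `sup_i |a_i| σ^i` of a family of coefficients be bounded
uniformly in `σ ∈ J`. It ensures that the supremum defining `|·|_J` is not a junk value. -/
def IsBoundedOn {L : Type*} [Norm L] (J : Polysegment ρ) (a : (Fin n → ℤ) → L) : Prop :=
  ∃ C, ∀ σ ∈ J.toSet, ∀ i, ‖a i‖ * wt σ i ≤ C

theorem IsBoundedOn.le_iSup {L : Type*} [Norm L] {a : (Fin n → ℤ) → L} (ha : IsBoundedOn J a)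
    {σ : Radii n} (hσ : σ ∈ J.toSet) (i : Fin n → ℤ) :
    ‖a i‖ * wt σ i ≤ ⨆ σ : J.toSet, ⨆ i : Fin n → ℤ, ‖a i‖ * wt σ i := by
  obtain ⟨C, hC⟩ := ha
  refine le_ciSup₂ (f := fun (σ : J.toSet) i => ‖a i‖ * wt σ i) ⟨C, ?_⟩ ⟨σ, hσ⟩ i
  rw [mem_upperBounds]
  rintro _ ⟨_, ⟨τ, rfl⟩, j, rfl⟩
  exact hC τ τ.2 j

theorem IsBoundedOn.add {L : Type*} [SeminormedAddGroup L] {a b : (Fin n → ℤ) → L}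
    (ha : IsBoundedOn J a) (hb : IsBoundedOn J b) : IsBoundedOn J (a + b) := by
  obtain ⟨C, hC⟩ := ha
  obtain ⟨D, hD⟩ := hb
  refine ⟨C + D, fun σ hσ i => ?_⟩
  calc ‖a i + b i‖ * wt σ i ≤ ‖a i‖ * wt σ i + ‖b i‖ * wt σ i := by
        rw [← add_mul]
        exact mul_le_mul_of_nonneg_right (norm_add_le _ _) (wt_pos σ i).le
    _ ≤ C + D := add_le_add (hC σ hσ i) (hD σ hσ i)

theorem isBoundedOn_of_decays {K : Type u} [NontriviallyNormedField K] {a : (Fin n → ℤ) → K}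
    (ha : ∀ σ ∈ J.toSet, Decays a σ) : IsBoundedOn J a := by
  choose C hC using fun s => (ha _ (J.vertex_mem s)).bound
  obtain ⟨D, hD⟩ := (Set.finite_range C).bddAbove
  refine ⟨D, fun σ hσ i => ?_⟩
  calc ‖a i‖ * wt σ i ≤ ‖a i‖ * wt (J.vertex fun j => 0 ≤ i j) i :=
        mul_le_mul_of_nonneg_left (J.wt_le_wt_vertex hσ i) (norm_nonneg _)
    _ ≤ C _ := hC _ i
    _ ≤ D := hD ⟨_, rfl⟩

end Bounded

section SegNorm

variable {K : Type u} [NontriviallyNormedField K] [CompleteSpace K] [IsUltrametricDist K]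
  {n : ℕ} {ρ : Radii n} {J : Polysegment ρ}

theorem isBoundedOn_coeffs (f : SegRing K J) : IsBoundedOn J (Laurent.coeffs f) :=
  isBoundedOn_of_decays (mem_principal.1 f.2)

theorem le_segNorm (f : SegRing K J) {σ : Radii n} (hσ : σ ∈ J.toSet) (i : Fin n → ℤ) :
    ‖Laurent.coeffs f i‖ * wt σ i ≤ segNorm f :=
  (isBoundedOn_coeffs f).le_iSup hσ i

theorem segNorm_le {f : SegRing K J} {C : ℝ} (hC : 0 ≤ C)
    (h : ∀ σ ∈ J.toSet, ∀ i, ‖Laurent.coeffs f i‖ * wt σ i ≤ C) : segNorm f ≤ C :=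
  Real.iSup_le (fun σ => Real.iSup_le (fun i => h σ σ.2 i) hC) hC

theorem segNorm_nonneg (f : SegRing K J) : 0 ≤ segNorm f :=
  Real.iSup_nonneg fun _ => Real.iSup_nonneg fun i =>
    mul_nonneg (norm_nonneg _) (wt_pos _ i).le

theorem one_le_segNorm_one : 1 ≤ segNorm (1 : SegRing K J) := by
  simpa [Laurent.coeffs_one, wt] using le_segNorm (1 : SegRing K J) J.mem_toSet 0

theorem segNorm_smul (c : K) (f : SegRing K J) : segNorm (c • f) = ‖c‖ * segNorm f := by
  simp only [segNorm, map_smul, Pi.smul_apply, norm_smul, mul_assoc,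
    Real.mul_iSup_of_nonneg (norm_nonneg c)]

theorem segNorm_sum_le {ι : Type*} (s : Finset ι) (f : ι → SegRing K J) {C : ℝ} (hC : 0 ≤ C)
    (h : ∀ x ∈ s, segNorm (f x) ≤ C) : segNorm (∑ x ∈ s, f x) ≤ C := by
  refine segNorm_le hC fun σ hσ i => ?_
  rw [map_sum, Finset.sum_apply, ← le_div_iff₀ (wt_pos σ i)]
  refine IsUltrametricDist.norm_sum_le_of_forall_le_of_nonneg
    (div_nonneg hC (wt_pos σ i).le) fun x hx => ?_
  rw [le_div_iff₀ (wt_pos σ i)]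
  exact (le_segNorm (f x) hσ i).trans (h x hx)

theorem exists_one_le_segNorm {ι : Type*} [Finite ι] [Nonempty ι] {s : Finset ι}
    {f : ι → SegRing K J} (h : 1 ≤ segNorm (∑ x ∈ s, f x)) : ∃ x, 1 ≤ segNorm (f x) := by
  obtain ⟨x, hx⟩ := Finite.exists_max fun x => segNorm (f x)
  exact ⟨x, h.trans (segNorm_sum_le s f (segNorm_nonneg _) fun y _ => hx y)⟩

theorem segNorm_mul_le (f g : SegRing K J) : segNorm (f * g) ≤ segNorm f * segNorm g := by
  have h0 : 0 ≤ segNorm f * segNorm g := mul_nonneg (segNorm_nonneg f) (segNorm_nonneg g)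
  refine segNorm_le h0 fun σ hσ k => ?_
  have hf : Decays (Laurent.coeffs f) σ := mem_principal.1 f.2 hσ
  have hg : Decays (Laurent.coeffs g) σ := mem_principal.1 g.2 hσ
  rw [Laurent.coeffs_mul, ← le_div_iff₀ (wt_pos σ k)]
  refine norm_tsum_le (hf.summable hg k) (div_nonneg h0 (wt_pos σ k).le) fun i => ?_
  have hk : wt σ k = wt σ i * wt σ (k - i) := by rw [← wt_add, add_sub_cancel]
  rw [le_div_iff₀ (wt_pos σ k), norm_mul, hk, mul_mul_mul_comm]
  exact mul_le_mul (le_segNorm f hσ i) (le_segNorm g hσ _)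
    (mul_nonneg (norm_nonneg _) (wt_pos _ _).le) (segNorm_nonneg f)

end SegNorm

section SegNormGam

variable {K : Type u} [NontriviallyNormedField K] [CompleteSpace K] [IsUltrametricDist K] {p : ℕ}

/-- The unique absolute value of `K(Γ)` extending the one of `K`. -/
abbrev normedFieldKGam : NormedField (KGam K p) := spectralNorm.normedField K (KGam K p)

attribute [local instance] normedFieldKGam rightModule

/-- `K(Γ)` as a normed algebra over `K`, that is, `normedFieldKGam` extends the absolute value. -/
abbrev normedAlgebraKGam : NormedAlgebra K (KGam K p) := spectralNorm.normedAlgebra K (KGam K p)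

attribute [local instance] normedAlgebraKGam

theorem isUltrametricDist_KGam : IsUltrametricDist (KGam K p) :=
  IsUltrametricDist.isUltrametricDist_of_isNonarchimedean_norm isNonarchimedean_spectralNorm

variable {n : ℕ}

theorem Gam.norm_char [Fact p.Prime] (ζ : Fin n → Gam K p) (i : Fin n → ℤ) :
    ‖char ζ i‖ = 1 := by
  obtain ⟨s, hs⟩ := (∏ j, ζ j ^ i j).2
  refine IsOfFinOrder.norm_eq_one (isOfFinOrder_iff_pow_eq_one.2
    ⟨p ^ s, pow_pos (Fact.out : p.Prime).pos s, ?_⟩)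
  exact congrArg Units.val hs

variable {F : Filter (Radii n)} [F.NeBot] {ρ : Radii n} {J : Polysegment ρ}

theorem coeffGam_smul (i : Fin n → ℤ) (a : KGam K p)
    (f : Laurent K F ⊗[K] KGam K p) : coeffGam i (a • f) = a • coeffGam i f := by
  induction f with
  | zero => simp
  | add f g hf hg => rw [smul_add, map_add, map_add, smul_add, hf, hg]
  | tmul g b => exact (mul_smul_comm (Laurent.coeffs g i) a b).symm

/-- The `i`-th coefficient `coeffGam i` as a `K(Γ)`-linear form. -/
def coeffGamForm (i : Fin n → ℤ) : Laurent K F ⊗[K] KGam K p →ₗ[KGam K p] KGam K p :=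
  { coeffGam i with map_smul' := coeffGam_smul i }

theorem isBoundedOn_coeffGam (f : SegRing K J ⊗[K] KGam K p) :
    IsBoundedOn J fun i => coeffGam i f := by
  induction f with
  | zero => exact ⟨0, fun σ _ i => by simp⟩
  | add f g hf hg =>
    simp only [map_add]
    exact hf.add hg
  | tmul g a =>
    refine ⟨segNorm g * ‖a‖, fun σ hσ i => ?_⟩
    change ‖Laurent.coeffs g i • a‖ * wt σ i ≤ _
    rw [norm_smul, mul_right_comm]
    exact mul_le_mul_of_nonneg_right (le_segNorm g hσ i) (norm_nonneg _)

theorem le_segNormGam (f : SegRing K J ⊗[K] KGam K p) {σ : Radii n} (hσ : σ ∈ J.toSet)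
    (i : Fin n → ℤ) : ‖coeffGam i f‖ * wt σ i ≤ segNormGam f :=
  (isBoundedOn_coeffGam f).le_iSup hσ i

end SegNormGam

/-! ### Coordinates over `K(Γ)` -/

section Coordinates

variable {K : Type u} [NontriviallyNormedField K] [CompleteSpace K] [IsUltrametricDist K] {p : ℕ}
  {n : ℕ} {F : Filter (Radii n)} [F.NeBot]

attribute [local instance] rightModule

section Module

variable {M : Type v} [AddCommGroup M] [Module K M] [Module (Laurent K F) M]
  [IsScalarTower K (Laurent K F) M] {ι : Type*} (e : Module.Basis ι (Laurent K F) M) (i : ι)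

/-- The `i`-th coordinate function on `M ⊗ K(Γ)` attached to a basis of `M`. -/
def coordGam : M ⊗[K] KGam K p →ₗ[KGam K p] Laurent K F ⊗[K] KGam K p :=
  rTensorRight ((e.coord i).restrictScalars K)

theorem coordGam_tmul (x : M) (a : KGam K p) : coordGam e i (x ⊗ₜ[K] a) = e.repr x i ⊗ₜ[K] a := rfl

theorem coordGam_extSmul [DecidableEq ι] (j : ι) (f : Laurent K F ⊗[K] KGam K p) :
    coordGam e i (extSmul f (e j ⊗ₜ[K] 1)) = if j = i then f else 0 := by
  induction f with
  | zero => simp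
  | add f g hf hg =>
    rw [map_add, LinearMap.add_apply, map_add, hf, hg]
    split_ifs <;> simp
  | tmul g a =>
    rw [extSmul, TensorProduct.map₂_apply_tmul, TensorProduct.map_tmul, coordGam_tmul]
    by_cases h : j = i
    · subst h; simp
    · simp [h]

end Module

variable [Fact p.Prime]

theorem Represents.coordGam_act {M : GammaModule.{u, v} K p F}
    {m : ℕ} {e : Module.Basis (Fin m) (Laurent K F) M.carrier} {ζ : Fin n → Gam K p}
    {E : Matrix (Fin m) (Fin m) (Laurent K F ⊗[K] KGam K p)} (hE : Represents M e ζ E)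
    (i j : Fin m) : coordGam e i (M.act ζ (e j ⊗ₜ[K] 1)) = E i j := by
  rw [hE j, map_sum]
  simp only [coordGam_extSmul]
  simp

attribute [local instance] normedFieldKGam normedAlgebraKGam

theorem GammaModule.norm_apply_proj_le (M : GammaModule.{u, v} K p F)
    (f : M.carrier ⊗[K] KGam K p →ₗ[KGam K p] KGam K p) {k : ℕ} (a : Fin n → ℤ)
    {x : M.carrier ⊗[K] KGam K p} {C : ℝ} (hC : 0 ≤ C)
    (hf : ∀ ζ ∈ Gam.level K p n k, ‖f (M.act ζ x)‖ ≤ C) :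
    ‖f (M.proj k a x)‖ ≤ ‖(p : K)‖⁻¹ ^ (k * n) * C := by
  have := isUltrametricDist_KGam (K := K) (p := p)
  have hp : ‖(p : KGam K p) ^ (k * n)‖⁻¹ = ‖(p : K)‖⁻¹ ^ (k * n) := by
    rw [← map_natCast (algebraMap K (KGam K p)), norm_pow, norm_algebraMap', inv_pow]
  rw [← hp]
  exact norm_apply_isotypicProj_le M.rep _ (χ := Gam.charHom a)
    (fun ζ _ => Gam.norm_char ζ a) f hC hf

theorem segNorm_repr_le_of_tmul_one_eq_proj {ρ : Radii n} {J : Polysegment ρ}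
    {M : GammaModule.{u, v} K p (𝓟 J.toSet)} {m : ℕ}
    (e : Module.Basis (Fin m) (SegRing K J) M.carrier) {k : ℕ} {C : ℝ} (hC : 0 ≤ C)
    (hE : ∀ ζ ∈ GamLevel K p n k, ∃ E : Matrix (Fin m) (Fin m) (SegRing K J ⊗[K] KGam K p),
      Represents M e ζ E ∧ ∀ i j, segNormGam (E i j) ≤ C)
    {a : Fin n → ℤ} {j : Fin m} {y : M.carrier}
    (hy : y ⊗ₜ[K] 1 = M.proj k a (e j ⊗ₜ[K] 1)) (i : Fin m) :
    segNorm (e.repr y i) ≤ ‖(p : K)‖⁻¹ ^ (k * n) * C := by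
  refine segNorm_le (by positivity) fun σ hσ ν => ?_
  let f : M.carrier ⊗[K] KGam K p →ₗ[KGam K p] KGam K p := coeffGamForm ν ∘ₗ coordGam e i
  have hcoeff : ‖f (y ⊗ₜ 1)‖ = ‖Laurent.coeffs (e.repr y i) ν‖ := by
    change ‖Laurent.coeffs (e.repr y i) ν • (1 : KGam K p)‖ = _
    rw [norm_smul, norm_one, mul_one]
  have hact (ζ) (hζ : ζ ∈ Gam.level K p n k) : ‖f (M.act ζ (e j ⊗ₜ 1))‖ ≤ C / wt σ ν := by
    obtain ⟨E, hrep, hbound⟩ := hE ζ (Gam.mem_level.1 hζ)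
    change ‖coeffGam ν (coordGam e i (M.act ζ (e j ⊗ₜ 1)))‖ ≤ _
    rw [hrep.coordGam_act, le_div_iff₀ (wt_pos σ ν)]
    exact (le_segNormGam _ hσ ν).trans (hbound i j)
  have hproj := M.norm_apply_proj_le f a (div_nonneg hC (wt_pos σ ν).le) hact
  rwa [← hy, hcoeff, ← mul_div_assoc, le_div_iff₀ (wt_pos σ ν)] at hproj

end Coordinates

/-! ### Exponents modulo powers of `p` -/

namespace GammaModule

variable {K : Type u} [NontriviallyNormedField K] [CompleteSpace K] [IsUltrametricDist K]
  {p : ℕ} [Fact p.Prime] {n : ℕ} {ρ : Radii n} {J : Polysegment ρ}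
  {M : GammaModule.{u, v} K p (𝓟 J.toSet)} {ι : Type*} [Fintype ι] [DecidableEq ι]
  {e : Module.Basis ι (SegRing K J) M.carrier} {k : ℕ} {a : ι → Fin n → ℤ} {v : ι → M.carrier}

attribute [local instance] rightModule

/-- The tuples of integers `a_j` form an exponent modulo `p^k`, as witnessed by the vectors `v_j`:
`v_j` is the projection of the basis vector `e_j` to the part of `M ⊗ K(Γ)` on which `Γ_k^n` acts
by `ζ ↦ ζ^{a_j}`, and the determinant of the `v_j` in the basis `e` has norm at least `1`. -/
def IsExponentMod (M : GammaModule.{u, v} K p (𝓟 J.toSet))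
    (e : Module.Basis ι (SegRing K J) M.carrier) (k : ℕ) (a : ι → Fin n → ℤ)
    (v : ι → M.carrier) : Prop :=
  (∀ j, v j ⊗ₜ[K] 1 = M.proj k (a j) (e j ⊗ₜ[K] 1)) ∧ 1 ≤ segNorm (e.det v)

theorem isExponentMod_zero (e : Module.Basis ι (SegRing K J) M.carrier) (a : ι → Fin n → ℤ) :
    M.IsExponentMod e 0 a e := by
  refine ⟨fun j => by rw [M.proj_zero, Module.End.one_apply], ?_⟩
  rw [e.det_self]
  exact one_le_segNorm_one

theorem IsExponentMod.act_tmul_one (h : M.IsExponentMod e k a v) {ζ : Fin n → Gam K p}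
    (hζ : ζ ∈ GamLevel K p n k) (j : ι) : M.act ζ (v j ⊗ₜ[K] 1) = v j ⊗ₜ[K] Gam.char ζ (a j) := by
  rw [h.1, M.act_proj _ _ (Gam.mem_level.2 hζ), ← h.1, smul_tmul_right, mul_one]

/- The vector `v_j` is the sum of its projections to the characters of `Γ_{k+1}^n` which restrict
to the given character of `Γ_k^n`, so that `det v` is a sum of determinants of such projections. By
the ultrametric inequality, one of them has norm at least `1`. -/
theorem IsExponentMod.exists_succ (hp : (p : K) ≠ 0) (hM : M.GaloisCompatible)
    (h : M.IsExponentMod e k a v) : ∃ (b : ι → Fin n → ℤ) (w : ι → M.carrier),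
      (∀ j r, (p : ℤ) ^ k ∣ b j r - a j r) ∧ M.IsExponentMod e (k + 1) b w := by
  have : NeZero p := ⟨(Fact.out : p.Prime).ne_zero⟩
  choose w hw using fun (j : ι) (c : Fin n → Fin p) =>
    hM.exists_tmul_one_eq_proj hp (k + 1) (Gam.lift k (a j) c) (e j)
  have hv : v = fun j => ∑ c, w j c := funext fun j => by
    apply tmul_one_injective K (KGam K p) M.carrier
    simp only [TensorProduct.sum_tmul, hw, h.1]
    rw [← M.sum_proj_lift hp, LinearMap.sum_apply]
  have hdet := h.2
  rw [hv, ← AlternatingMap.coe_multilinearMap, MultilinearMap.map_sum] at hdet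
  obtain ⟨c, hc⟩ := exists_one_le_segNorm hdet
  exact ⟨fun j => Gam.lift k (a j) (c j), fun j => w j (c j),
    fun j r => ⟨(c j r : ℕ), by simp [Gam.lift]⟩, fun j => hw j (c j), hc⟩

theorem GaloisCompatible.exists_isExponentMod (hp : (p : K) ≠ 0) (hM : M.GaloisCompatible)
    (e : Module.Basis ι (SegRing K J) M.carrier) :
    ∃ (a : ℕ → ι → Fin n → ℤ) (v : ℕ → ι → M.carrier),
      (∀ k j r, (p : ℤ) ^ k ∣ a (k + 1) j r - a k j r) ∧ ∀ k, M.IsExponentMod e k (a k) (v k) := by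
  have hstep (k : ℕ) (s : {s : (ι → Fin n → ℤ) × (ι → M.carrier) // M.IsExponentMod e k s.1 s.2}) :
      ∃ t : {t : (ι → Fin n → ℤ) × (ι → M.carrier) // M.IsExponentMod e (k + 1) t.1 t.2},
        ∀ j r, (p : ℤ) ^ k ∣ t.1.1 j r - s.1.1 j r := by
    obtain ⟨b, w, hdvd, hw⟩ := s.2.exists_succ hp hM
    exact ⟨⟨(b, w), hw⟩, hdvd⟩
  choose next hnext using hstep
  let s : (k : ℕ) → {s : (ι → Fin n → ℤ) × (ι → M.carrier) // M.IsExponentMod e k s.1 s.2} :=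
    fun k => Nat.rec ⟨(0, e), isExponentMod_zero e 0⟩ next k
  exact ⟨fun k => (s k).1.1, fun k => (s k).1.2, fun k => hnext k (s k), fun k => (s k).2⟩

end GammaModule

/-! ### Existence of exponents and change of basis -/

theorem exists_pow_mul_rpow_le {b : ℝ} (hb : 1 < b) {C : ℝ} (hC : 0 ≤ C) {l : ℝ} (hl : 0 < l) :
    ∃ l' : ℝ, 0 < l' ∧ ∀ k : ℕ, C ^ k * b ^ (l * k) ≤ b ^ (l' * k) := by
  obtain ⟨s, hs⟩ := pow_unbounded_of_one_lt C hb
  have hb0 : 0 < b := one_pos.trans hb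
  refine ⟨s + l, by positivity, fun k => ?_⟩
  rw [add_mul, Real.rpow_add hb0, Real.rpow_mul_natCast hb0.le s, Real.rpow_natCast]
  gcongr

section ChangeOfBasis

variable {K : Type u} [NontriviallyNormedField K] [CompleteSpace K] [IsUltrametricDist K]
  {n : ℕ} {ρ : Radii n} {J : Polysegment ρ} {M : Type*} [AddCommGroup M] [Module (SegRing K J) M]
  {ι : Type*}

theorem exists_segNorm_repr_le [Finite ι] (e e' : Module.Basis ι (SegRing K J) M) :
    ∃ C, ∀ (x : M) (D : ℝ), (∀ i, segNorm (e.repr x i) ≤ D) →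
      ∀ i, segNorm (e'.repr x i) ≤ C * D := by
  cases nonempty_fintype ι
  obtain ⟨C, hC⟩ :=
    (Set.finite_range fun q : ι × ι => segNorm (e'.repr (e q.2) q.1)).bddAbove
  refine ⟨C, fun x D hx i => ?_⟩
  have hCi (s : ι) : segNorm (e'.repr (e s) i) ≤ C := hC ⟨(i, s), rfl⟩
  have hC0 : 0 ≤ C := (segNorm_nonneg _).trans (hCi i)
  have hD0 : 0 ≤ D := (segNorm_nonneg _).trans (hx i)
  have hrepr : e'.repr x i = ∑ s, e'.repr (e s) i * e.repr x s :=
    (congrFun (congrFun (e'.toMatrix_mul_toMatrix e fun _ : Unit => x) i) ()).symm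
  rw [hrepr]
  refine segNorm_sum_le _ _ (mul_nonneg hC0 hD0) fun s _ => (segNorm_mul_le _ _).trans ?_
  exact mul_le_mul (hCi s) (hx s) (segNorm_nonneg _) hC0

variable [Module K M] [IsScalarTower K (SegRing K J) M] [Fintype ι] [DecidableEq ι]

theorem det_smul_eq (e : Module.Basis ι (SegRing K J) M) (c : K) (v : ι → M) :
    e.det (fun j => c • v j) = c ^ Fintype.card ι • e.det v := by
  simp only [← algebraMap_smul (SegRing K J) c]
  rw [e.det.map_smul_univ, Finset.prod_const, Finset.card_univ, ← map_pow, algebraMap_smul]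

theorem exists_forall_one_le_segNorm_det_smul (e e' : Module.Basis ι (SegRing K J) M) :
    ∃ c : K, ∀ v : ι → M, 1 ≤ segNorm (e.det v) → 1 ≤ segNorm (e'.det fun j => c • v j) := by
  obtain ⟨c, hc⟩ := NormedField.exists_lt_norm K (max 1 (segNorm (e.det e')))
  obtain ⟨hc1, hcd⟩ := max_lt_iff.1 hc
  refine ⟨c, fun v hv => ?_⟩
  rcases isEmpty_or_nonempty ι
  · rw [e'.det_apply, Matrix.det_isEmpty]
    exact one_le_segNorm_one
  have hdet : e.det v = e.det e' * e'.det v := by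
    conv_lhs => rw [e.det.eq_smul_basis_det e']
    rfl
  calc 1 ≤ segNorm (e.det e') * segNorm (e'.det v) := hv.trans (hdet ▸ segNorm_mul_le _ _)
    _ ≤ ‖c‖ ^ Fintype.card ι * segNorm (e'.det v) :=
      mul_le_mul_of_nonneg_right (hcd.le.trans (le_self_pow₀ hc1.le Fintype.card_ne_zero))
        (segNorm_nonneg _)
    _ = segNorm (e'.det fun j => c • v j) := by rw [det_smul_eq, segNorm_smul, norm_pow]

end ChangeOfBasis

namespace Model

variable {K : Type u} [NontriviallyNormedField K] [CompleteSpace K] [IsUltrametricDist K]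
  {p : ℕ} [Fact p.Prime] {n : ℕ} {ρ : Radii n} {P : GammaModule.{u, v} K p (𝓝 ρ)} {M : Model P}
  {m : ℕ}

attribute [local instance] rightModule

theorem isExponent_iff_exists_vectors {e : Module.Basis (Fin m) (SegRing K M.J) M.P'.carrier}
    {A : Fin n → Matrix (Fin m) (Fin m) ℤ_[p]} :
    M.IsExponent e A ↔ (∀ r, (A r).IsDiag) ∧ ∃ v : ℕ → Fin m → M.P'.carrier,
      (∀ k : ℕ, 0 < k → ∀ ζ ∈ GamLevel K p n k, ∀ j, M.P'.act ζ (v k j ⊗ₜ[K] 1) =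
        v k j ⊗ₜ[K] Gam.val (∏ r, Gam.padicPow (ζ r) (A r j j))) ∧
      (∃ l : ℝ, 0 < l ∧ ∀ k : ℕ, 0 < k → ∀ i j,
        segNorm (e.repr (v k j) i) ≤ (p : ℝ) ^ (l * k)) ∧
      ∀ k : ℕ, 0 < k → 1 ≤ segNorm (e.det (v k)) := by
  refine and_congr_right fun _ => ⟨fun ⟨S, hact, hbound, hdet⟩ => ?_,
    fun ⟨v, hact, hbound, hdet⟩ => ⟨fun k => e.toMatrix (v k), ?_, hbound, ?_⟩⟩
  · have hS (k) : e.toMatrix (fun j => ∑ i, S k i j • e i) = S k := by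
      ext1 i j
      exact congrFun (e.repr_sum_self fun i => S k i j) i
    refine ⟨fun k j => ∑ i, S k i j • e i, hact, ?_, fun k hk => ?_⟩
    · obtain ⟨l, hl, hle⟩ := hbound
      refine ⟨l, hl, fun k hk i j => ?_⟩
      rw [← e.toMatrix_apply fun j => ∑ i, S k i j • e i, hS]
      exact hle k hk i j
    · rw [e.det_apply, hS]
      exact hdet k hk
  · simpa only [e.sum_toMatrix_smul_self] using hact
  · simpa only [e.det_apply] using hdet

theorem IsExponent.change_basis {e : Module.Basis (Fin m) (SegRing K M.J) M.P'.carrier}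
    {A : Fin n → Matrix (Fin m) (Fin m) ℤ_[p]} (h : M.IsExponent e A)
    (e' : Module.Basis (Fin m) (SegRing K M.J) M.P'.carrier) : M.IsExponent e' A := by
  rw [isExponent_iff_exists_vectors] at h ⊢
  obtain ⟨hA, v, hact, ⟨l, hl, hbound⟩, hdet⟩ := h
  obtain ⟨C, hC⟩ := exists_segNorm_repr_le e e'
  obtain ⟨c, hc⟩ := exists_forall_one_le_segNorm_det_smul e e'
  obtain ⟨l', hl', hle⟩ := exists_pow_mul_rpow_le
    (Nat.one_lt_cast.2 (Fact.out : p.Prime).one_lt) (zero_le_one.trans (le_max_left 1 (‖c‖ * C))) hl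
  refine ⟨hA, fun k j => c • v k j, fun k hk ζ hζ j => ?_, ⟨l', hl', fun k hk i j => ?_⟩,
    fun k hk => hc _ (hdet k hk)⟩
  · rw [← TensorProduct.smul_tmul', ← TensorProduct.smul_tmul', ← algebraMap_smul_right,
      M.P'.act_smul, hact k hk ζ hζ, algebraMap_smul_right]
  · have hrepr : e'.repr (c • v k j) i = c • e'.repr (v k j) i := by
      rw [← algebraMap_smul (SegRing K M.J) c, map_smul, Finsupp.smul_apply, algebraMap_smul]
    calc segNorm (e'.repr (c • v k j) i) = ‖c‖ * segNorm (e'.repr (v k j) i) := by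
          rw [hrepr, segNorm_smul]
      _ ≤ ‖c‖ * (C * (p : ℝ) ^ (l * k)) :=
        mul_le_mul_of_nonneg_left (hC _ _ (fun s => hbound k hk s j) i) (norm_nonneg c)
      _ = ‖c‖ * C * (p : ℝ) ^ (l * k) := (mul_assoc _ _ _).symm
      _ ≤ max 1 (‖c‖ * C) ^ k * (p : ℝ) ^ (l * k) := by
        gcongr
        exact (le_max_right _ _).trans (le_self_pow₀ (le_max_left _ _) hk.ne')
      _ ≤ (p : ℝ) ^ (l' * k) := hle k

theorem exists_isExponent (hp : (p : K) ≠ 0) (hP : P.GaloisCompatible) (M : Model P) :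
    ∃ (m : ℕ) (e : Module.Basis (Fin m) (SegRing K M.J) M.P'.carrier)
      (A : Fin n → Matrix (Fin m) (Fin m) ℤ_[p]), M.IsExponent e A := by
  obtain ⟨m, e, l, hl, hE⟩ := M.bounded
  obtain ⟨a, v, hdvd, hv⟩ := (M.galoisCompatible hP).exists_isExponentMod hp e
  choose A hA using fun (r : Fin n) (j : Fin m) =>
    exists_padicInt_toZModPow_eq (p := p) (a := fun k => a k j r) (fun k => hdvd k j r)
  obtain ⟨l', hl', hle⟩ := exists_pow_mul_rpow_le
    (Nat.one_lt_cast.2 (Fact.out : p.Prime).one_lt) (C := ‖(p : K)‖⁻¹ ^ n) (by positivity) hl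
  refine ⟨m, e, fun r => Matrix.diagonal (A r), isExponent_iff_exists_vectors.2
    ⟨fun r => Matrix.isDiag_diagonal _, v, fun k _ ζ hζ j => ?_, ⟨l', hl', fun k hk i j => ?_⟩,
      fun k _ => (hv k).2⟩⟩
  · rw [(hv k).act_tmul_one hζ, Gam.val_prod_padicPow hζ fun r => ?_]
    rw [Matrix.diagonal_apply_eq]
    exact hA r j k
  · calc segNorm (e.repr (v k j) i)
        ≤ ‖(p : K)‖⁻¹ ^ (k * n) * (p : ℝ) ^ (l * k) :=
          segNorm_repr_le_of_tmul_one_eq_proj e (by positivity) (hE k hk) ((hv k).1 j) i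
      _ = (‖(p : K)‖⁻¹ ^ n) ^ k * (p : ℝ) ^ (l * k) := by rw [mul_comm k, pow_mul]
      _ ≤ (p : ℝ) ^ (l' * k) := hle k

end Model

end PAdicFuchs

end

theorem mainTheorem6_general (p : ℕ) [Fact p.Prime] (K : Type*) [NontriviallyNormedField K]
    [CompleteSpace K] [IsUltrametricDist K] (hp : (p : K) ≠ 0)
    (n : ℕ) (ρ : PAdicFuchs.Radii n) (P : PAdicFuchs.Crho K p ρ)
    (m : ℕ) (hm : Module.finrank (PAdicFuchs.GermRing K ρ) P.carrier = m) :
    (∃ A : Fin n → Matrix (Fin m) (Fin m) ℤ_[p], P.IsExponent A) ∧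
    ∀ M : PAdicFuchs.Model P.toGammaModule,
      ∃ A : Fin n → Matrix (Fin m) (Fin m) ℤ_[p],
        ∀ e : Module.Basis (Fin m) (PAdicFuchs.SegRing K M.J) M.P'.carrier,
          M.IsExponent e A := by
  have hmodel (M : PAdicFuchs.Model P.toGammaModule) :
      ∃ A : Fin n → Matrix (Fin m) (Fin m) ℤ_[p],
        ∀ e : Module.Basis (Fin m) (PAdicFuchs.SegRing K M.J) M.P'.carrier,
          M.IsExponent e A := by
    obtain ⟨r, e, A, hA⟩ := PAdicFuchs.Model.exists_isExponent hp P.galois M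
    obtain rfl : r = m := by
      rw [← hm, M.finrank_eq, Module.finrank_eq_card_basis e, Fintype.card_fin]
    exact ⟨A, hA.change_basis⟩
  obtain ⟨M⟩ := P.exists_model
  obtain ⟨A, hA⟩ := hmodel M
  let e := Module.finBasisOfFinrankEq (PAdicFuchs.SegRing K M.J) M.P'.carrier
    (M.finrank_eq.symm.trans hm)
  exact ⟨⟨A, M, e, hA e⟩, hmodel⟩

theorem mainTheorem6 (p : ℕ) [Fact p.Prime] (K : Type*) [NontriviallyNormedField K]
    [CompleteSpace K] [IsUltrametricDist K] (hp : ‖(p : K)‖ = (p : ℝ)⁻¹)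
    (n : ℕ) (ρ : PAdicFuchs.Radii n) (P : PAdicFuchs.Crho K p ρ)
    (m : ℕ) (hm : Module.finrank (PAdicFuchs.GermRing K ρ) P.carrier = m) :
    (∃ A : Fin n → Matrix (Fin m) (Fin m) ℤ_[p], P.IsExponent A) ∧
    ∀ M : PAdicFuchs.Model P.toGammaModule,
      ∃ A : Fin n → Matrix (Fin m) (Fin m) ℤ_[p],
        ∀ e : Module.Basis (Fin m) (PAdicFuchs.SegRing K M.J) M.P'.carrier,
          M.IsExponent e A := by
  have hp0 : (p : K) ≠ 0 := norm_ne_zero_iff.1 (hp ▸ inv_ne_zero (NeZero.ne (p : ℝ)))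
  exact mainTheorem6_general p K hp0 n ρ P m hm
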